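/- For an integer $N\ge 2$ and a real number $k>0$ let $X_{k,N}$ be a random vector with values in the closed Weyl chamber $C_N^A=\{x\in\mathbb R^N: x_1\ge x_2\ge\dots\ge x_N\}$ whose law has the Lebesgue density $$c_k^A\, e^{-\|x\|_2^2/2}\prod_{1\le i<j\le N}(x_i-x_j)^{2k}\quad (x\in C_N^A),\qquad c_k^A=\Bigl(\int_{C_N^A}e^{-\|y\|_2^2/2}\prod_{i<j}(y_i-y_j)^{2k}\,dy\Bigr)^{-1}$$ (the ordered $\beta$-Hermite ensemble with $\beta=2k$). Let $\mathbf z_N\in C_N^A$ be the vector of the $N$ zeros, in decreasing order, of the Hermite polynomial $H_N$, where $(H_n)_{n\ge0}$ are orthogonal with respect to the density $e^{-x^2}$ on $\mathbb R$. Let $N\ge 2$, $k\ge e$, and let $c$ satisfy $$\sqrt{\frac{1+\ln N}{2\ln k}}\le c\le \frac12\sqrt{\frac{k}{N\ln k}}.$$ Then $$P\Bigl(\Bigl\|\frac{X_{k,N}}{\sqrt{2k}}-\mathbf z_N\Bigr\|_2>c\Bigl(\frac{\ln k}{k}\Bigr)^{1/2}\Bigr)\le \frac{32}{3}c^4N^3\frac{(\ln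 k)^2}{k}+\frac{\sqrt e\,N}{2}\,(2c^2\ln k+1)\,k^{-c^2}.$$ Moreover, as $k\to\infty$ and uniformly in $N\ge 2$, $$P\Bigl(\Bigl\|\frac{X_{k,N}}{\sqrt{2k}}-\mathbf z_N\Bigr\|_2>\Bigl(\frac{\ln k}{k}\Bigr)^{1/2}\Bigr)=O\Bigl(N^3\frac{(\ln k)^2}{k}\Bigr),$$ and, for each fixed $0<c<1$, as $k\to\infty$ and uniformly in $N\ge2$ (with an implied constant that may depend on $c$), $$P\Bigl(\Bigl\|\frac{X_{k,N}}{\sqrt{2k}}-\mathbf z_N\Bigr\|_2>c\Bigl(\frac{\ln k}{k}\Bigr)^{1/2}\Bigr)=O\Bigl(N^3\frac{\ln k}{k^{c^2}}\Bigr).$$ -/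

import Mathlib

open MeasureTheory ProbabilityTheory Filter

noncomputable section

/-- The Hermite polynomials orthogonal with respect to `e^{-x²}` ("physicists'" normalization),
given by `H₀ = 1` and `Hₙ₊₁ = 2 x Hₙ - Hₙ'`. (Mathlib's `Polynomial.hermite` is the family
orthogonal with respect to `e^{-x²/2}`.) -/
def physHermite : ℕ → Polynomial ℝ
  | 0 => 1
  | n + 1 => 2 * Polynomial.X * physHermite n - Polynomial.derivative (physHermite n)

/-- The vector `z_N` of the `N` zeros of `H_N` in decreasing order. Since `H_N` has `N` distinct
real zeros, the sorted list has length `N` and the default value `0` is never used. -/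
def hermiteZeros (N : ℕ) : EuclideanSpace ℝ (Fin N) :=
  WithLp.toLp 2 fun i => ((physHermite N).roots.sort (· ≥ ·)).getD (i : ℕ) 0

/-- The closed Weyl chamber `{x : x₁ ≥ x₂ ≥ … ≥ x_N}`. -/
def weylChamberA (N : ℕ) : Set (EuclideanSpace ℝ (Fin N)) :=
  {x | ∀ i j : Fin N, i ≤ j → x j ≤ x i}

/-- The unnormalized density `e^{-‖x‖₂²/2} ∏_{i<j} (x_i - x_j)^{2k}`, used on the Weyl chamber. -/
def hermiteWeight (N : ℕ) (k : ℝ) (x : EuclideanSpace ℝ (Fin N)) : ℝ :=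
  Real.exp (-‖x‖ ^ 2 / 2) * ∏ i : Fin N, ∏ j ∈ Finset.Ioi i, (x i - x j) ^ (2 * k)

/-- The normalization constant of the Hermite ensemble. -/
def hermiteConst (N : ℕ) (k : ℝ) : ℝ :=
  (∫ y in weylChamberA N, hermiteWeight N k y)⁻¹

/-- The law of the ordered `β`-Hermite ensemble with `β = 2k`: the measure on the Weyl chamber with
Lebesgue density `hermiteConst N k * hermiteWeight N k x`. -/
def hermiteEnsemble (N : ℕ) (k : ℝ) : Measure (EuclideanSpace ℝ (Fin N)) :=
  (volume.restrict (weylChamberA N)).withDensity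
    fun x => ENNReal.ofReal (hermiteConst N k * hermiteWeight N k x)

end

/-! Write the rescaled ensemble as `z_N + h`. Because the Hermite zeros satisfy the Stieltjes
equations, they are a critical point of the energy. In the relative gaps `u_p = (h_i - h_j) / (z_i -
z_j)` the density becomes, up to a constant, `exp(-k‖h‖² - 2k ∑ (u_p - log (1 + u_p)))`. Its
quadratic approximation `exp(-k (‖h‖² + ∑ u_p²))` is Gaussian, and the Hermite differential equation
shows that the quadratic form has eigenvalues `1, …, N` (`hermiteZeros_stieltjes_and_hessian`).
`exists_hessian_whitening` turns this form into `‖x‖²`.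

The density is compared with the Gaussian through two one-sided estimates, and the normalizing
constant is never computed. The total mass is at most `exp(N / (9k))` times the Gaussian mass
(`lintegral_logGas_le`). For this bound, each gap is transported by a shifted cube root along a
Parseval frame, in the manner of a geometric Brascamp–Lieb inequality. The mass of the ball `‖h‖² ≤
R` is at least `exp(-4k(NR)²/3)` times its Gaussian mass (`le_setLIntegral_logGasDensity`):
averaging over `±h` removes the odd terms. A Chernoff bound (`lintegral_gaussian_tail_le`) controls
the Gaussian tail.

Dividing the two estimates gives `hermiteEnsemble_concentration`; `R = c² log k / k` gives the
explicit bound. For the uniform statements, whenever the range condition on `c` fails, the claimed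
bound already exceeds one. -/

/-! ### Hermite polynomials: recursions, and reality and simplicity of the zeros. -/

open Polynomial in
theorem physHermite_succ (n : ℕ) :
    physHermite (n + 1) = 2 * X * physHermite n - derivative (physHermite n) := rfl

open Polynomial in
/-- The derivative rule for Hermite polynomials together with the Hermite differential equation. -/
theorem physHermite_derivative_succ_and_ode (n : ℕ) :
    derivative (physHermite (n + 1)) = 2 * ((n : ℝ[X]) + 1) * physHermite n ∧
      derivative (derivative (physHermite n)) - 2 * X * derivative (physHermite n)
        + 2 * (n : ℝ[X]) * physHermite n = 0 := by
  induction n with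
  | zero => simp [physHermite]
  | succ n ih =>
    obtain ⟨h1, -⟩ := ih
    have hode : derivative (derivative (physHermite (n + 1)))
        - 2 * X * derivative (physHermite (n + 1))
        + 2 * ((n + 1 : ℕ) : ℝ[X]) * physHermite (n + 1) = 0 := by
      have h2 : derivative (derivative (physHermite (n + 1)))
          = 2 * ((n : ℝ[X]) + 1) * derivative (physHermite n) := by
        rw [h1, derivative_mul]; simp
      rw [h2, h1, physHermite_succ]; push_cast; ring
    refine ⟨?_, hode⟩
    rw [physHermite_succ (n + 1), derivative_sub, derivative_mul, derivative_mul]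
    simp only [derivative_X, derivative_ofNat]
    push_cast at hode ⊢
    linear_combination -hode

open Polynomial in
theorem physHermite_derivative_succ (n : ℕ) :
    derivative (physHermite (n + 1)) = 2 * ((n : ℝ[X]) + 1) * physHermite n :=
  (physHermite_derivative_succ_and_ode n).1

open Polynomial in
theorem physHermite_ode (n : ℕ) :
    derivative (derivative (physHermite n)) - 2 * X * derivative (physHermite n)
        + 2 * (n : ℝ[X]) * physHermite n = 0 :=
  (physHermite_derivative_succ_and_ode n).2

open Polynomial in
theorem physHermite_degree_and_leadingCoeff (n : ℕ) :
    (physHermite n).natDegree = n ∧ (physHermite n).leadingCoeff = 2 ^ n := by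
  induction n with
  | zero => simp [physHermite]
  | succ n ih =>
    obtain ⟨hd, hl⟩ := ih
    have hne : physHermite n ≠ 0 := by
      intro h
      rw [h, leadingCoeff_zero] at hl
      exact pow_ne_zero n two_ne_zero hl.symm
    have h2 : (2 * X : ℝ[X]) = C 2 * X := by rw [C_ofNat]
    have hdeg : (2 * X * physHermite n).natDegree = n + 1 := by
      rw [h2, natDegree_mul (by simp) hne, natDegree_C_mul_X _ (by norm_num), hd, add_comm]
    have hlead : (2 * X * physHermite n).leadingCoeff = 2 ^ (n + 1) := by
      rw [h2, leadingCoeff_mul, hl, leadingCoeff_C_mul_X, pow_succ, mul_comm]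
    have hlt : (derivative (physHermite n)).degree < (2 * X * physHermite n).degree := by
      refine lt_of_le_of_lt (degree_derivative_le) ?_
      refine degree_lt_degree ?_
      omega
    rw [physHermite_succ, leadingCoeff_sub_of_degree_lt hlt, hlead]
    refine ⟨?_, rfl⟩
    rw [natDegree_eq_of_degree_eq (degree_sub_eq_left_of_degree_lt hlt), hdeg]

theorem physHermite_natDegree (n : ℕ) : (physHermite n).natDegree = n :=
  (physHermite_degree_and_leadingCoeff n).1

theorem physHermite_ne_zero (n : ℕ) : physHermite n ≠ 0 := by
  intro h
  have := (physHermite_degree_and_leadingCoeff n).2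
  rw [h, Polynomial.leadingCoeff_zero] at this
  exact pow_ne_zero n two_ne_zero this.symm

open Polynomial in
theorem physHermite_three_term (n : ℕ) :
    physHermite (n + 2) = 2 * X * physHermite (n + 1) - 2 * ((n : ℝ[X]) + 1) * physHermite n := by
  rw [physHermite_succ (n + 1), physHermite_derivative_succ]

open Polynomial in
/-- Imaginary part of the Christoffel–Darboux identity on the diagonal. -/
theorem physHermite_im_christoffel_darboux (ζ : ℂ) (n : ℕ) :
    ζ.im * ∑ m ∈ Finset.range (n + 1),
        Complex.normSq (aeval ζ (physHermite m)) / (2 ^ m * m.factorial) =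
      (aeval ζ (physHermite (n + 1)) * starRingEnd ℂ (aeval ζ (physHermite n))).im
        / (2 ^ (n + 1) * n.factorial) := by
  induction n with
  | zero =>
    simp [physHermite, map_ofNat (aeval ζ : ℝ[X] →ₐ[ℝ] ℂ) 2]
  | succ n ih =>
    rw [Finset.sum_range_succ, mul_add, ih, physHermite_three_term]
    simp only [map_sub, map_mul, aeval_X, map_ofNat, map_add, map_natCast, map_one]
    set a := aeval ζ (physHermite (n + 1))
    set b := aeval ζ (physHermite n)
    simp only [Complex.normSq_apply, Complex.mul_im, Complex.sub_im, Complex.mul_re,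
      Complex.sub_re, Complex.conj_re, Complex.conj_im, Complex.add_re, Complex.add_im,
      Complex.natCast_re, Complex.natCast_im, Complex.one_re, Complex.one_im,
      Complex.re_ofNat, Complex.im_ofNat]
    rw [Nat.factorial_succ]
    push_cast
    have : (n.factorial : ℝ) ≠ 0 := by exact_mod_cast n.factorial_ne_zero
    have : (n + 1 : ℝ) ≠ 0 := by positivity
    field_simp
    ring

-- At a root the right side of the Christoffel–Darboux identity vanishes, while the sum on the left
-- is positive because `H₀ = 1`.
open Polynomial in
theorem physHermite_im_eq_zero_of_root (n : ℕ) (ζ : ℂ) (h : aeval ζ (physHermite n) = 0) :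
    ζ.im = 0 := by
  cases n with
  | zero => simp [physHermite] at h
  | succ n =>
    have key := physHermite_im_christoffel_darboux ζ n
    rw [h, zero_mul, Complex.zero_im, zero_div] at key
    refine (mul_eq_zero.1 key).resolve_right (ne_of_gt ?_)
    refine Finset.sum_pos' (fun m _ => div_nonneg (Complex.normSq_nonneg _) (by positivity))
      ⟨0, by simp, ?_⟩
    simp [physHermite]

open Polynomial in
theorem physHermite_splits (n : ℕ) : (physHermite n).Splits := by
  refine Splits.of_splits_map (algebraMap ℝ ℂ) (IsAlgClosed.splits _) ?_
  intro ζ hζ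
  rw [mem_roots', IsRoot, eval_map_algebraMap] at hζ
  exact ⟨ζ.re, Complex.ext rfl (physHermite_im_eq_zero_of_root n ζ hζ.2).symm⟩

-- Descent: a common zero of `Hₙ₊₁` and its derivative is a zero of `Hₙ` by the derivative rule,
-- then of `Hₙ'` by the defining recursion. This would end at `H₀ = 1`.
open Polynomial in
theorem physHermite_derivative_eval_ne_zero (n : ℕ) (x : ℝ) (hx : (physHermite n).eval x = 0) :
    (derivative (physHermite n)).eval x ≠ 0 := by
  induction n with
  | zero => simp [physHermite] at hx
  | succ n ih =>
    intro hd
    rw [physHermite_derivative_succ] at hd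
    have h0 : (physHermite n).eval x = 0 := by
      have h2 : (n + 1 : ℝ) ≠ 0 := by positivity
      simpa [h2] using hd
    apply ih h0
    rw [physHermite_succ] at hx
    simpa [h0] using hx

open Polynomial in
theorem physHermite_roots_nodup (n : ℕ) : (physHermite n).roots.Nodup := by
  rw [Multiset.nodup_iff_count_le_one]
  intro a
  rw [count_roots]
  by_contra hlt
  push Not at hlt
  have hroots := (one_lt_rootMultiplicity_iff_isRoot (physHermite_ne_zero n)).1 hlt
  exact physHermite_derivative_eval_ne_zero n a hroots.1 hroots.2

theorem physHermite_sort_length (n : ℕ) :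
    ((physHermite n).roots.sort (· ≥ ·)).length = n := by
  rw [Multiset.length_sort, ← (physHermite_splits n).natDegree_eq_card_roots,
    physHermite_natDegree]

theorem hermiteZeros_apply (N : ℕ) (i : Fin N) :
    hermiteZeros N i = ((physHermite N).roots.sort (· ≥ ·))[(i : ℕ)]'(by
      rw [physHermite_sort_length]; exact i.2) := by
  exact List.getD_eq_getElem _ _ _

theorem hermiteZeros_isRoot (N : ℕ) (i : Fin N) :
    (physHermite N).eval (hermiteZeros N i) = 0 := by
  have h : hermiteZeros N i ∈ (physHermite N).roots.sort (· ≥ ·) := by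
    rw [hermiteZeros_apply]; exact List.getElem_mem _
  rw [Multiset.mem_sort] at h
  exact (Polynomial.mem_roots'.1 h).2

theorem hermiteZeros_strictAnti (N : ℕ) : StrictAnti (hermiteZeros N : Fin N → ℝ) := by
  intro i j hij
  rw [hermiteZeros_apply, hermiteZeros_apply]
  have hs := Multiset.pairwise_sort (physHermite N).roots (· ≥ ·)
  have hn : ((physHermite N).roots.sort (· ≥ ·)).Nodup := by
    rw [← Multiset.coe_nodup, Multiset.sort_eq]; exact physHermite_roots_nodup N
  have h1 := List.pairwise_iff_getElem.1 hs i j (by rw [physHermite_sort_length]; exact i.2)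
    (by rw [physHermite_sort_length]; exact j.2) hij
  have h2 := List.pairwise_iff_getElem.1 hn i j (by rw [physHermite_sort_length]; exact i.2)
    (by rw [physHermite_sort_length]; exact j.2) hij
  exact lt_of_le_of_ne h1 (Ne.symm h2)

/-! ### Sums and products over pairs of indices. -/

/-- Ordered pairs `i < j` of indices. -/
abbrev IncPair (N : ℕ) : Type := {p : Fin N × Fin N // p.1 < p.2}

theorem prod_incPair {N : ℕ} {M : Type*} [CommMonoid M] (F : Fin N → Fin N → M) :
    ∏ p : IncPair N, F p.1.1 p.1.2 = ∏ i, ∏ j ∈ Finset.Ioi i, F i j := by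
  rw [← Finset.prod_subtype (Finset.univ.filter fun p : Fin N × Fin N => p.1 < p.2) (by simp)
    (fun p : Fin N × Fin N => F p.1 p.2), Finset.prod_filter, Fintype.prod_prod_type]
  refine Finset.prod_congr rfl fun i _ => ?_
  rw [← Finset.prod_filter]
  congr 1
  ext j; simp

theorem sum_incPair {N : ℕ} {M : Type*} [AddCommMonoid M] (F : Fin N → Fin N → M) :
    ∑ p : IncPair N, F p.1.1 p.1.2 = ∑ i, ∑ j ∈ Finset.Ioi i, F i j :=
  prod_incPair (M := Multiplicative M) F

/-- Summation by parts. It turns the gradient and Hessian of the pair interaction, given as sums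
over pairs, into the coordinatewise sums that the Hermite identities evaluate. -/
theorem sum_incPair_sub_mul {N : ℕ} (x : Fin N → ℝ) (G : Fin N → Fin N → ℝ)
    (hG : ∀ i j, G j i = -G i j) :
    ∑ p : IncPair N, (x p.1.1 - x p.1.2) * G p.1.1 p.1.2 = ∑ i, x i * ∑ j, G i j := by
  rw [sum_incPair fun i j => (x i - x j) * G i j]
  have hswap : ∑ i, ∑ j ∈ Finset.Ioi i, x j * G i j
      = ∑ i, ∑ j ∈ Finset.Iio i, x i * G j i := by
    refine Finset.sum_comm' ?_
    intro i j; simp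
  have hsplit : ∀ i : Fin N, ∑ j, G i j
      = ∑ j ∈ Finset.Ioi i, G i j + ∑ j ∈ Finset.Iio i, G i j := by
    intro i
    have hii : G i i = 0 := by linarith [hG i i]
    have hdisj : Disjoint (Finset.Ioi i) (Finset.Iio i) := by
      rw [Finset.disjoint_left]; intro j h1 h2
      simp only [Finset.mem_Ioi, Finset.mem_Iio] at h1 h2
      exact lt_asymm h1 h2
    rw [← Finset.sum_union hdisj]
    refine (Finset.sum_subset (Finset.subset_univ _) ?_).symm
    intro j _ hj
    simp only [Finset.mem_union, Finset.mem_Ioi, Finset.mem_Iio, not_or, not_lt] at hj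
    rw [le_antisymm hj.1 hj.2, hii]
  simp_rw [sub_mul, Finset.sum_sub_distrib]
  rw [hswap, ← Finset.sum_sub_distrib]
  refine Finset.sum_congr rfl fun i _ => ?_
  rw [hsplit i, mul_add, Finset.mul_sum, Finset.mul_sum, sub_eq_add_neg, ← Finset.sum_neg_distrib]
  congr 1
  refine Finset.sum_congr rfl fun j _ => ?_
  rw [hG i j]; ring

/-! ### Interpolation at the Hermite zeros; critical point and Hessian of the logarithmic energy. -/

open Polynomial in
theorem Polynomial.derivative_eval_of_eq_X_sub_C_mul {p q : ℝ[X]} {a : ℝ} (h : p = (X - C a) * q)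
    (x : ℝ) : (derivative p).eval x = (x - a) * (derivative q).eval x + q.eval x := by
  rw [h, derivative_mul]; simp; ring

open Polynomial in
theorem Polynomial.derivative2_eval_of_eq_X_sub_C_mul {p q : ℝ[X]} {a : ℝ}
    (h : p = (X - C a) * q) (x : ℝ) :
    (derivative (derivative p)).eval x =
      (x - a) * (derivative (derivative q)).eval x + 2 * (derivative q).eval x := by
  rw [h, derivative_mul, derivative_add, derivative_mul]; simp; ring

-- The cofactors `q j = H_N / (X - z_j)` are the unnormalized Lagrange basis, with `q j (z_j) =
-- H_N'(z_j)`. In this basis the differential operator `g'' - 2 x g'` can be evaluated at the zeros.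
open Polynomial in
theorem exists_lagrange_basis_hermiteZeros (N : ℕ) : ∃ q : Fin N → ℝ[X],
    (∀ j, physHermite N = (X - C (hermiteZeros N j)) * q j) ∧
    ∀ g : ℝ[X], g.degree < N → g = ∑ j, C (g.eval (hermiteZeros N j) /
      (derivative (physHermite N)).eval (hermiteZeros N j)) * q j := by
  have hdvd : ∀ j : Fin N, ∃ q, physHermite N = (X - C (hermiteZeros N j)) * q := fun j =>
    dvd_iff_isRoot.2 (hermiteZeros_isRoot N j)
  choose q hq using hdvd
  refine ⟨q, hq, fun g hg => ?_⟩
  have hqdeg : ∀ j, (q j).degree < N := by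
    intro j
    have hne : q j ≠ 0 := by
      intro h; apply physHermite_ne_zero N; rw [hq j, h, mul_zero]
    have h1 := congrArg natDegree (hq j)
    rw [natDegree_mul (X_sub_C_ne_zero _) hne, natDegree_X_sub_C, physHermite_natDegree] at h1
    rw [degree_eq_natDegree hne]
    exact_mod_cast (by omega : (q j).natDegree < N)
  have hinj : Function.Injective (hermiteZeros N : Fin N → ℝ) :=
    (hermiteZeros_strictAnti N).injective
  refine eq_of_degrees_lt_of_eval_index_eq (s := Finset.univ) (v := (hermiteZeros N : Fin N → ℝ))
    hinj.injOn (by simpa using hg) ?_ ?_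
  · simp only [Finset.card_univ, Fintype.card_fin]
    refine lt_of_le_of_lt (degree_sum_le _ _) ?_
    refine (Finset.sup_lt_iff (WithBot.bot_lt_coe N)).2 fun j _ => ?_
    rw [C_mul']
    exact lt_of_le_of_lt (degree_smul_le _ _) (hqdeg j)
  · intro i _
    have hi := derivative_eval_of_eq_X_sub_C_mul (hq i) (hermiteZeros N i)
    rw [sub_self, zero_mul, zero_add] at hi
    rw [eval_finsetSum, Finset.sum_eq_single i]
    · rw [eval_mul, eval_C, ← hi, div_mul_cancel₀]
      exact physHermite_derivative_eval_ne_zero N _ (hermiteZeros_isRoot N i)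
    · intro j _ hji
      have h0 := congrArg (eval (hermiteZeros N i)) (hq j)
      rw [hermiteZeros_isRoot, eval_mul, eval_sub, eval_X, eval_C] at h0
      have hne : hermiteZeros N i - hermiteZeros N j ≠ 0 :=
        sub_ne_zero.2 fun h => hji (hinj h).symm
      rw [eval_mul, (mul_eq_zero.1 h0.symm).resolve_left hne, mul_zero]
    · simp

open Polynomial in
/-- The logarithmic-equilibrium equations for the Hermite zeros, and the eigenvectors of the Hessian
of the logarithmic energy at the Hermite zeros. The diagonal terms of both sums vanish, since
division by zero gives zero. -/
theorem hermiteZeros_stieltjes_and_hessian {N : ℕ} (hN : 0 < N) :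
    (∀ i, ∑ j, 1 / (hermiteZeros N i - hermiteZeros N j) = hermiteZeros N i) ∧
    ∀ n < N, ∀ v : Fin N → ℝ,
      (∀ i, v i = (physHermite n).eval (hermiteZeros N i) /
        (derivative (physHermite N)).eval (hermiteZeros N i)) →
      ∀ i, ∑ j, (v i - v j) / (hermiteZeros N i - hermiteZeros N j) ^ 2
        = ((N : ℝ) - 1 - n) * v i := by
  obtain ⟨q, hq, hlag⟩ := exists_lagrange_basis_hermiteZeros N
  obtain ⟨K, rfl⟩ : ∃ K, N = K + 1 := ⟨N - 1, by omega⟩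
  set z : Fin (K + 1) → ℝ := (hermiteZeros (K + 1) : Fin (K + 1) → ℝ) with hz
  set p := physHermite (K + 1) with hp
  have hinj : Function.Injective z := (hermiteZeros_strictAnti (K + 1)).injective
  have hroot : ∀ i, p.eval (z i) = 0 := hermiteZeros_isRoot (K + 1)
  have hd0 : ∀ i, (derivative p).eval (z i) ≠ 0 := fun i =>
    physHermite_derivative_eval_ne_zero _ _ (hroot i)
  have hsub : ∀ i j, j ≠ i → z i - z j ≠ 0 := fun i j h => sub_ne_zero.2 fun e => h (hinj e).symm
  have hode : ∀ i, (derivative (derivative p)).eval (z i)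
      = 2 * z i * (derivative p).eval (z i) := by
    intro i
    have h := congrArg (eval (z i)) (physHermite_ode (K + 1))
    rw [← hp] at h
    simp only [eval_add, eval_sub, eval_mul, eval_X, hroot, eval_ofNat, eval_zero, mul_zero,
      add_zero] at h
    linarith
  have hq0 : ∀ i j, j ≠ i → (q j).eval (z i) = 0 := by
    intro i j hji
    have h0 := congrArg (eval (z i)) (hq j)
    rw [hroot, eval_mul, eval_sub, eval_X, eval_C] at h0
    exact (mul_eq_zero.1 h0.symm).resolve_left (hsub i j hji)
  have hq1 : ∀ i j, j ≠ i →
      (derivative (q j)).eval (z i) = (derivative p).eval (z i) / (z i - z j) := by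
    intro i j hji
    have h := derivative_eval_of_eq_X_sub_C_mul (hq j) (z i)
    rw [hq0 i j hji, add_zero] at h
    rw [h]; field_simp [hsub i j hji]
  -- Off the diagonal, the operator `D g = g'' - 2 x g'` in the Lagrange basis has the entries `1 /
  -- (z_i - z_j)²` of the energy's Hessian, up to the factor `-2 H_N'(z_i)`.
  have hq2 : ∀ i j, j ≠ i → (derivative (derivative (q j))).eval (z i)
      - 2 * z i * (derivative (q j)).eval (z i)
        = -2 * (derivative p).eval (z i) / (z i - z j) ^ 2 := by
    intro i j hji
    have h := derivative2_eval_of_eq_X_sub_C_mul (hq j) (z i)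
    have h1 := hsub i j hji
    rw [hode, hq1 i j hji] at h
    rw [hq1 i j hji]
    change _ = (z i - z j) * _ + _ at h
    field_simp at h ⊢
    linear_combination -h
  have hqi : ∀ i, 2 * (derivative (q i)).eval (z i) = 2 * z i * (derivative p).eval (z i) := by
    intro i
    have h := derivative2_eval_of_eq_X_sub_C_mul (hq i) (z i)
    rw [hode, sub_self, zero_mul, zero_add] at h
    exact h.symm
  have hdp : derivative p = ∑ j, q j := by
    have h := hlag (derivative p) (by
      rw [hp, physHermite_derivative_succ]
      refine lt_of_le_of_lt (b := (physHermite K).degree) ?_ ?_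
      · have : (2 * ((K : ℝ[X]) + 1)) = C (2 * ((K : ℝ) + 1)) := by
          rw [C_mul, C_add, C_ofNat, C_1, C_eq_natCast]
        rw [this, C_mul']; exact degree_smul_le _ _
      · rw [degree_eq_natDegree (physHermite_ne_zero K), physHermite_natDegree]
        exact_mod_cast Nat.lt_succ_self K)
    refine h.trans (Finset.sum_congr rfl fun j _ => ?_)
    rw [div_self (hd0 j), C_1, one_mul]
  refine ⟨fun i => ?_, fun n hn v hv i => ?_⟩
  · have h : (derivative (derivative p)).eval (z i) = ∑ j, (derivative (q j)).eval (z i) := by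
      conv_lhs => rw [hdp]
      rw [derivative_sum, eval_finsetSum]
    have h2 : ∑ j, (derivative (q j)).eval (z i)
        = (derivative (q i)).eval (z i) + (derivative p).eval (z i) * ∑ j, 1 / (z i - z j) := by
      rw [Finset.mul_sum, ← Finset.add_sum_erase _ _ (Finset.mem_univ i),
        ← Finset.add_sum_erase _ (fun j => (derivative p).eval (z i) * (1 / (z i - z j)))
          (Finset.mem_univ i)]
      simp only [sub_self, div_zero, mul_zero, zero_add]
      congr 1
      refine Finset.sum_congr rfl fun j hj => ?_
      rw [hq1 i j (Finset.ne_of_mem_erase hj)]; ring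
    rw [hode, h2] at h
    have := hqi i
    refine mul_left_cancel₀ (hd0 i) ?_
    linarith
  · have hsum : ∀ (g : ℝ[X]) (w : Fin (K + 1) → ℝ) (m : ℝ), g = ∑ j, C (w j) * q j →
        (derivative (derivative g) - 2 * X * derivative g).eval (z i) = -(2 * m) * g.eval (z i) →
        ∑ j, w j * ((derivative (derivative (q j))).eval (z i)
          - 2 * z i * (derivative (q j)).eval (z i)) = -(2 * m) * g.eval (z i) := by
      intro g w m hg hm
      rw [← hm]
      conv_rhs => rw [hg]
      simp only [derivative_sum, derivative_C_mul, eval_sub, eval_mul, eval_finsetSum, eval_C,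
        eval_X, eval_ofNat, Finset.mul_sum, ← Finset.sum_sub_distrib]
      refine Finset.sum_congr rfl fun j _ => ?_
      ring
    have hodem : ∀ m : ℕ, (derivative (derivative (physHermite m))
        - 2 * X * derivative (physHermite m)).eval (z i)
          = -(2 * (m : ℝ)) * (physHermite m).eval (z i) := by
      intro m
      have h := congrArg (eval (z i)) (physHermite_ode m)
      simp only [eval_add, eval_mul, eval_ofNat, eval_natCast, eval_zero] at h
      linarith
    have h1 := hsum (physHermite n) v n (by
        conv_lhs => rw [hlag (physHermite n) (by
          rw [degree_eq_natDegree (physHermite_ne_zero n), physHermite_natDegree]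
          exact_mod_cast hn)]
        refine Finset.sum_congr rfl fun j _ => ?_
        rw [hv j]) (hodem n)
    -- `H_N'` has all Lagrange coefficients equal to one and is a multiple of `H_{N-1}`, hence an
    -- eigenvector of `D`. Subtracting the expansion of `H_n` from `v i` times this one removes the
    -- diagonal entry, which need not be computed, and leaves the eigenvalue `N - 1 - n`.
    have h2 := hsum (derivative p) (fun _ => 1) K (by simpa using hdp) (by
        have h := hodem K
        have hc : derivative p = C (2 * ((K : ℝ) + 1)) * physHermite K := by
          rw [hp, physHermite_derivative_succ, C_mul, C_add, C_ofNat, C_1, C_eq_natCast]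
        rw [hc]
        simp only [derivative_C_mul, eval_sub, eval_mul, eval_C, eval_X, eval_ofNat] at h ⊢
        linear_combination (2 * ((K : ℝ) + 1)) * h)
    have hvi : (physHermite n).eval (z i) = v i * (derivative p).eval (z i) := by
      rw [hv i, div_mul_cancel₀]; exact hd0 i
    have h3 : ∑ j, (v i - v j) * ((derivative (derivative (q j))).eval (z i)
          - 2 * z i * (derivative (q j)).eval (z i))
        = -(2 * (derivative p).eval (z i)) * ∑ j, (v i - v j) / (z i - z j) ^ 2 := by
      rw [Finset.mul_sum]
      refine Finset.sum_congr rfl fun j _ => ?_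
      by_cases hji : j = i
      · rw [hji]; simp
      · rw [hq2 i j hji]; ring
    simp only [one_mul] at h2
    simp_rw [sub_mul (v i)] at h3
    rw [Finset.sum_sub_distrib, ← Finset.mul_sum, h1, h2, hvi] at h3
    refine mul_left_cancel₀ (mul_ne_zero two_ne_zero (hd0 i)) ?_
    push_cast
    linarith

/-- The relative displacement `(hᵢ - hⱼ) / (zᵢ - zⱼ)` of two Hermite zeros. -/
noncomputable def relGap {N : ℕ} (p : IncPair N) : EuclideanSpace ℝ (Fin N) →L[ℝ] ℝ :=
  (1 / (hermiteZeros N p.1.1 - hermiteZeros N p.1.2)) •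
    (EuclideanSpace.proj p.1.1 - EuclideanSpace.proj p.1.2)

theorem relGap_apply {N : ℕ} (p : IncPair N) (h : EuclideanSpace ℝ (Fin N)) :
    relGap p h = (h p.1.1 - h p.1.2) / (hermiteZeros N p.1.1 - hermiteZeros N p.1.2) := by
  simp [relGap, div_eq_inv_mul]

theorem hermiteZeros_sub_pos {N : ℕ} (p : IncPair N) :
    0 < hermiteZeros N p.1.1 - hermiteZeros N p.1.2 :=
  sub_pos.2 (hermiteZeros_strictAnti N p.2)

/-- The Hermite zeros are a critical point of the logarithmic energy. -/
theorem inner_hermiteZeros_eq_sum_relGap {N : ℕ} (hN : 0 < N) (h : EuclideanSpace ℝ (Fin N)) :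
    inner ℝ (hermiteZeros N) h = ∑ p : IncPair N, relGap p h := by
  have key := sum_incPair_sub_mul (fun i => h i)
    (fun i j => 1 / (hermiteZeros N i - hermiteZeros N j)) (by
      intro i j; rw [← neg_sub, div_neg])
  simp only [(hermiteZeros_stieltjes_and_hessian hN).1] at key
  simp only [relGap_apply, PiLp.inner_apply, RCLike.inner_apply, conj_trivial]
  rw [← key]
  exact Finset.sum_congr rfl fun p _ => by rw [mul_one_div]

/-- Eigenvectors of the Hessian of the logarithmic energy at the Hermite zeros. -/
theorem exists_hessian_eigenvector {N : ℕ} (l : Fin N) :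
    ∃ v : EuclideanSpace ℝ (Fin N), v ≠ 0 ∧ ∀ h : EuclideanSpace ℝ (Fin N),
      inner ℝ v h + ∑ p : IncPair N, relGap p v * relGap p h = ((l : ℝ) + 1) * inner ℝ v h := by
  have hN : 0 < N := lt_of_le_of_lt (Nat.zero_le _) l.2
  -- Reversing the degree makes the interaction eigenvalue `l`; the confining term `‖h‖²` adds one.
  set n := N - 1 - (l : ℕ) with hn
  have hnN : n < N := by omega
  set v : EuclideanSpace ℝ (Fin N) := WithLp.toLp 2 fun i =>
    (physHermite n).eval (hermiteZeros N i) /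
      (Polynomial.derivative (physHermite N)).eval (hermiteZeros N i) with hv
  refine ⟨v, ?_, fun h => ?_⟩
  -- A nonzero polynomial of degree below `N` cannot vanish at `N` distinct points.
  · intro h0
    refine physHermite_ne_zero n (Polynomial.eq_zero_of_degree_lt_of_eval_index_eq_zero
      (s := Finset.univ) (v := (hermiteZeros N : Fin N → ℝ))
      (hermiteZeros_strictAnti N).injective.injOn ?_ fun i _ => ?_)
    · rw [Polynomial.degree_eq_natDegree (physHermite_ne_zero n), physHermite_natDegree]
      simpa using hnN
    · have hi : v i = 0 := by rw [h0]; rfl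
      exact (div_eq_zero_iff.1 hi).resolve_right
        (physHermite_derivative_eval_ne_zero N _ (hermiteZeros_isRoot N i))
  · have key := sum_incPair_sub_mul (fun i => h i)
      (fun i j => (v i - v j) / (hermiteZeros N i - hermiteZeros N j) ^ 2) (by
        intro i j; rw [← neg_sub (v i), ← neg_sub (hermiteZeros N i), neg_sq, neg_div])
    simp only [(hermiteZeros_stieltjes_and_hessian hN).2 n hnN v fun i => rfl] at key
    have hl : (N : ℝ) - 1 - n = l := by
      have h1 : (N : ℝ) = ((n + 1 + l : ℕ) : ℝ) := congrArg _ (by omega)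
      rw [h1]; push_cast; ring
    have hsum : ∑ p : IncPair N, relGap p v * relGap p h = (l : ℝ) * inner ℝ v h := by
      simp only [PiLp.inner_apply, RCLike.inner_apply, conj_trivial, Finset.mul_sum]
      rw [hl] at key
      rw [Finset.sum_congr rfl fun i _ => (by ring : (l : ℝ) * (h i * v i) = h i * (l * v i)),
        ← key]
      refine Finset.sum_congr rfl fun p _ => ?_
      rw [relGap_apply, relGap_apply, div_mul_div_comm, ← sq, mul_comm, mul_div_assoc]
    rw [hsum]; ring

/-- The quadratic form of the Hessian has the simple eigenvalues `1, …, N`. -/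
theorem exists_hessian_orthonormalBasis (N : ℕ) :
    ∃ e : OrthonormalBasis (Fin N) ℝ (EuclideanSpace ℝ (Fin N)),
      ∀ h : EuclideanSpace ℝ (Fin N),
        ‖h‖ ^ 2 + ∑ p : IncPair N, relGap p h ^ 2 =
          ∑ l : Fin N, ((l : ℝ) + 1) * inner ℝ (e l) h ^ 2 := by
  choose v hv0 hv using exists_hessian_eigenvector (N := N)
  have horth : ∀ l m, l ≠ m → inner ℝ (v l) (v m) = 0 := by
    intro l m hlm
    have h1 := hv l (v m)
    have h2 := hv m (v l)
    have h3 : inner ℝ (v l) (v m) = inner ℝ (v m) (v l) := real_inner_comm _ _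
    have h4 : ∑ p : IncPair N, relGap p (v l) * relGap p (v m)
        = ∑ p : IncPair N, relGap p (v m) * relGap p (v l) :=
      Finset.sum_congr rfl fun p _ => mul_comm _ _
    have hne : (l : ℝ) - m ≠ 0 := by
      rw [sub_ne_zero]; exact_mod_cast fun h => hlm (Fin.ext h)
    refine (mul_eq_zero.1 (?_ : ((l : ℝ) - m) * inner ℝ (v l) (v m) = 0)).resolve_left hne
    rw [h4, h3] at h1
    rw [h3]
    linarith
  set w : Fin N → EuclideanSpace ℝ (Fin N) := fun l => (1 / ‖v l‖) • v l with hw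
  have hwo : Orthonormal ℝ w := by
    refine ⟨fun l => ?_, fun l m hlm => ?_⟩
    · have := norm_ne_zero_iff.2 (hv0 l)
      rw [hw, norm_smul, norm_div, norm_one, norm_norm]; field_simp
    · simp only [hw, inner_smul_left, inner_smul_right, horth l m hlm, mul_zero]
  have hwe : ∀ l h, inner ℝ (w l) h + ∑ p : IncPair N, relGap p (w l) * relGap p h
      = ((l : ℝ) + 1) * inner ℝ (w l) h := by
    intro l h
    simp only [hw, inner_smul_left, map_smul, smul_eq_mul, conj_trivial, mul_assoc,
      ← Finset.mul_sum]
    rw [← mul_add, hv l h]; ring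
  have hspan : ⊤ ≤ Submodule.span ℝ (Set.range w) := by
    rw [(hwo.linearIndependent.span_eq_top_of_card_eq_finrank' (by simp))]
  refine ⟨OrthonormalBasis.mk hwo hspan, fun h => ?_⟩
  simp only [OrthonormalBasis.coe_mk]
  have hexp : h = ∑ l, (inner ℝ (w l) h : ℝ) • w l := by
    have := (OrthonormalBasis.mk hwo hspan).sum_repr' h
    simp only [OrthonormalBasis.coe_mk] at this
    exact this.symm
  have h1 : ‖h‖ ^ 2 = ∑ l, inner ℝ (w l) h * inner ℝ (w l) h := by
    rw [← real_inner_self_eq_norm_sq]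
    have h := congrArg (fun y => inner ℝ y h) hexp
    rw [sum_inner] at h
    refine h.trans (Finset.sum_congr rfl fun l _ => ?_)
    rw [inner_smul_left, conj_trivial]
  have h2 : ∀ p : IncPair N, relGap p h ^ 2
      = ∑ l, inner ℝ (w l) h * (relGap p (w l) * relGap p h) := by
    intro p
    have h := congrArg (fun y => relGap p y * relGap p h) hexp
    rw [map_sum, Finset.sum_mul] at h
    rw [sq]
    refine h.trans (Finset.sum_congr rfl fun l _ => ?_)
    rw [map_smul, smul_eq_mul, mul_assoc]
  rw [h1, Finset.sum_congr rfl fun p _ => h2 p, Finset.sum_comm, ← Finset.sum_add_distrib]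
  refine Finset.sum_congr rfl fun l _ => ?_
  rw [← Finset.mul_sum, ← mul_add, hwe]; ring

/-- Linear coordinates in which the Hessian of the logarithmic energy at the Hermite zeros becomes
the identity. -/
theorem exists_hessian_whitening (N : ℕ) :
    ∃ L : EuclideanSpace ℝ (Fin N) ≃L[ℝ] EuclideanSpace ℝ (Fin N),
      ∀ x : EuclideanSpace ℝ (Fin N),
        ‖L x‖ ^ 2 = ∑ l : Fin N, x l ^ 2 / ((l : ℝ) + 1) ∧
        ‖L x‖ ^ 2 + ∑ p : IncPair N, relGap p (L x) ^ 2 = ‖x‖ ^ 2 := by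
  obtain ⟨e, he⟩ := exists_hessian_orthonormalBasis N
  let L₀ : EuclideanSpace ℝ (Fin N) →ₗ[ℝ] EuclideanSpace ℝ (Fin N) :=
    ∑ l : Fin N, (1 / √((l : ℝ) + 1)) •
      ((EuclideanSpace.proj l : EuclideanSpace ℝ (Fin N) →L[ℝ] ℝ).smulRight (e l)).toLinearMap
  have hL₀ : ∀ x, L₀ x = ∑ l : Fin N, (x l / √((l : ℝ) + 1)) • e l := by
    intro x
    simp only [L₀, LinearMap.sum_apply, LinearMap.smul_apply]
    refine Finset.sum_congr rfl fun l _ => ?_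
    simp [smul_smul, div_eq_inv_mul]
  have hsqrt : ∀ l : Fin N, √((l : ℝ) + 1) ^ 2 = (l : ℝ) + 1 := fun l =>
    Real.sq_sqrt (by positivity)
  have hpos : ∀ l : Fin N, (0 : ℝ) < (l : ℝ) + 1 := fun l => by positivity
  have hinner : ∀ x l, inner ℝ (e l) (L₀ x) = x l / √((l : ℝ) + 1) := by
    intro x l
    rw [hL₀]
    exact e.orthonormal.inner_right_fintype _ l
  have h1 : ∀ x, ‖L₀ x‖ ^ 2 = ∑ l : Fin N, x l ^ 2 / ((l : ℝ) + 1) := by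
    intro x
    rw [← e.sum_sq_norm_inner_right (L₀ x)]
    refine Finset.sum_congr rfl fun l _ => ?_
    rw [hinner, Real.norm_eq_abs, sq_abs, div_pow, hsqrt]
  have h2 : ∀ x, ‖L₀ x‖ ^ 2 + ∑ p : IncPair N, relGap p (L₀ x) ^ 2 = ‖x‖ ^ 2 := by
    intro x
    rw [he, EuclideanSpace.norm_sq_eq]
    refine Finset.sum_congr rfl fun l _ => ?_
    rw [hinner, Real.norm_eq_abs, sq_abs, div_pow, hsqrt, mul_div_cancel₀ _ (hpos l).ne']
  have hinj : Function.Injective L₀ := by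
    rw [injective_iff_map_eq_zero]
    intro x hx
    have := h2 x
    rw [hx] at this
    simpa using this.symm
  exact ⟨(LinearEquiv.ofInjectiveEndo L₀ hinj).toContinuousLinearEquiv, fun x => ⟨h1 x, h2 x⟩⟩

/-! ### Parseval frames and transport to the Gaussian. -/

section BrascampLieb

variable {E ι : Type*} [NormedAddCommGroup E] [InnerProductSpace ℝ E] [Fintype ι]

/-- The frame operator `∑ m, t m • b m ⊗ b m`. -/
noncomputable def frameOperator (b : ι → E) (t : ι → ℝ) : E →L[ℝ] E :=
  ∑ m, t m • (innerSL ℝ (b m)).smulRight (b m)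

theorem frameOperator_apply (b : ι → E) (t : ι → ℝ) (x : E) :
    frameOperator b t x = ∑ m, (t m * inner ℝ (b m) x) • b m := by
  simp [frameOperator, smul_smul]

theorem inner_frameOperator (b : ι → E) (t : ι → ℝ) (x y : E) :
    inner ℝ (frameOperator b t x) y = ∑ m, t m * (inner ℝ (b m) x * inner ℝ (b m) y) := by
  rw [frameOperator_apply, sum_inner]
  exact Finset.sum_congr rfl fun m _ => by rw [inner_smul_left, conj_trivial, mul_assoc]

theorem isSymmetric_frameOperator (b : ι → E) (t : ι → ℝ) :
    (frameOperator b t : E →ₗ[ℝ] E).IsSymmetric := by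
  intro x y
  rw [real_inner_comm _ x]
  simp only [ContinuousLinearMap.coe_coe, inner_frameOperator]
  exact Finset.sum_congr rfl fun m _ => by ring

/-- The synthesis map is the adjoint of the isometric analysis map, hence a contraction. -/
theorem norm_sum_smul_sq_le_of_parseval {b : ι → E} (hb : ∀ x, ∑ m, inner ℝ (b m) x ^ 2 = ‖x‖ ^ 2)
    (t : ι → ℝ) : ‖∑ m, t m • b m‖ ^ 2 ≤ ∑ m, t m ^ 2 := by
  set v := ∑ m, t m • b m with hv
  have h1 : ‖v‖ ^ 2 = ∑ m, t m * inner ℝ (b m) v := by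
    rw [← real_inner_self_eq_norm_sq]
    conv_lhs => rw [hv, sum_inner]
    exact Finset.sum_congr rfl fun m _ => by rw [inner_smul_left, conj_trivial]
  have h2 : ∑ m, (t m * inner ℝ (b m) v) ≤ ∑ m, (t m ^ 2 + inner ℝ (b m) v ^ 2) / 2 :=
    Finset.sum_le_sum fun m _ => by nlinarith [sq_nonneg (t m - inner ℝ (b m) v)]
  rw [← Finset.sum_div, Finset.sum_add_distrib, hb] at h2
  linarith

variable [FiniteDimensional ℝ E]

/-- Both sides are the trace of the identity `∑ b m ⊗ b m`. -/
theorem sum_norm_sq_of_parseval {b : ι → E} (hb : ∀ x, ∑ m, inner ℝ (b m) x ^ 2 = ‖x‖ ^ 2) :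
    ∑ m, ‖b m‖ ^ 2 = Module.finrank ℝ E := by
  have e := stdOrthonormalBasis ℝ E
  have h1 : ∀ m, ‖b m‖ ^ 2 = ∑ l, inner ℝ (b m) (e l) ^ 2 := by
    intro m
    rw [← e.sum_sq_norm_inner_left (b m)]
    exact Finset.sum_congr rfl fun l _ => by rw [Real.norm_eq_abs, sq_abs]
  rw [Finset.sum_congr rfl fun m _ => h1 m, Finset.sum_comm,
    Finset.sum_congr rfl fun l _ => hb (e l)]
  simp

/-- Determinant inequality for Parseval frames. -/
theorem prod_rpow_le_det_frameOperator {b : ι → E}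
    (hb : ∀ x, ∑ m, inner ℝ (b m) x ^ 2 = ‖x‖ ^ 2) {t : ι → ℝ} (ht : ∀ m, 0 < t m) :
    ∏ m, t m ^ (‖b m‖ ^ 2) ≤ (frameOperator b t).det := by
  have hS := isSymmetric_frameOperator b t
  set e := hS.eigenvectorBasis rfl with he
  have hdet : (frameOperator b t).det = ∏ l, hS.eigenvalues rfl l := by
    have := hS.det_eq_prod_eigenvalues rfl
    exact this
  have heig : ∀ l, hS.eigenvalues rfl l = ∑ m, inner ℝ (b m) (e l) ^ 2 * t m := by
    intro l
    have h1 := inner_frameOperator b t (e l) (e l)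
    have h2 : frameOperator b t (e l) = (hS.eigenvalues rfl l) • e l :=
      hS.apply_eigenvectorBasis rfl l
    rw [h2, inner_smul_left, real_inner_self_eq_norm_sq, e.norm_eq_one] at h1
    simp only [conj_trivial, one_pow, mul_one] at h1
    rw [h1]
    exact Finset.sum_congr rfl fun m _ => by ring
  have hnorm : ∀ m, ‖b m‖ ^ 2 = ∑ l, inner ℝ (b m) (e l) ^ 2 := by
    intro m
    rw [← e.sum_sq_norm_inner_left (b m)]
    exact Finset.sum_congr rfl fun l _ => by rw [Real.norm_eq_abs, sq_abs]
  calc ∏ m, t m ^ (‖b m‖ ^ 2) = ∏ l, ∏ m, t m ^ (inner ℝ (b m) (e l) ^ 2) := by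
        rw [Finset.prod_comm]
        refine Finset.prod_congr rfl fun m _ => ?_
        rw [hnorm, Real.rpow_sum_of_pos (ht m)]
    -- Each eigenvalue is an average of the `t m` with weights `⟨b m, e l⟩²`, which sum to one, so
    -- weighted AM–GM applies to each factor.
    _ ≤ ∏ l, hS.eigenvalues rfl l := by
        refine Finset.prod_le_prod (fun l _ => Finset.prod_nonneg fun m _ =>
          (Real.rpow_nonneg (ht m).le _)) fun l _ => ?_
        rw [heig]
        refine Real.geom_mean_le_arith_mean_weighted _ _ _ (fun m _ => sq_nonneg _) ?_
          fun m _ => (ht m).le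
        rw [hb, e.norm_eq_one, one_pow]
    _ = _ := hdet.symm

variable [MeasurableSpace E] [BorelSpace E]

/-- A geometric Brascamp–Lieb inequality, in the form of a transport to the standard Gaussian. -/
theorem lintegral_parseval_transport_le {b : ι → E}
    (hb : ∀ x, ∑ m, inner ℝ (b m) x ^ 2 = ‖x‖ ^ 2) {κ : ℝ} (hκ : 0 ≤ κ) {S : Set E}
    (hS : MeasurableSet S) {I : ι → Set ℝ} {T T' : ι → ℝ → ℝ}
    (hSI : ∀ x ∈ S, ∀ m, inner ℝ (b m) x ∈ I m)
    (hT : ∀ m, ∀ u ∈ I m, HasDerivAt (T m) (T' m u) u) (hT' : ∀ m, ∀ u ∈ I m, 0 < T' m u)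
    (hmono : ∀ m, StrictMonoOn (T m) (I m)) :
    ∫⁻ x in S, ENNReal.ofReal ((∏ m, T' m (inner ℝ (b m) x) ^ (‖b m‖ ^ 2)) *
        Real.exp (-κ * ∑ m, T m (inner ℝ (b m) x) ^ 2)) ≤
      ∫⁻ y : E, ENNReal.ofReal (Real.exp (-κ * ‖y‖ ^ 2)) := by
  set Ψ : E → E := fun x => ∑ m, T m (inner ℝ (b m) x) • b m with hΨ
  set Ψ' : E → E →L[ℝ] E := fun x => frameOperator b fun m => T' m (inner ℝ (b m) x) with hΨ'
  have hderiv : ∀ x ∈ S, HasFDerivWithinAt Ψ (Ψ' x) S x := by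
    intro x hx
    refine HasFDerivAt.hasFDerivWithinAt ?_
    refine HasFDerivAt.fun_sum fun m _ => ?_
    have h1 : HasFDerivAt (fun x => inner ℝ (b m) x) (innerSL ℝ (b m)) x :=
      (innerSL ℝ (b m)).hasFDerivAt
    have h2 := ((hT m _ (hSI x hx m)).comp_hasFDerivAt x h1).smul_const (b m)
    have h3 : T' m (inner ℝ (b m) x) • (innerSL ℝ (b m)).smulRight (b m)
        = (T' m (inner ℝ (b m) x) • innerSL ℝ (b m)).smulRight (b m) := by
      ext y; simp [smul_smul]
    rw [← h3] at h2
    exact h2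
  -- Monotonicity: `⟨Ψ x - Ψ y, x - y⟩` is a sum of nonnegative terms. If it is zero, all frame
  -- coefficients of `x` and `y` agree.
  have hinj : Set.InjOn Ψ S := by
    intro x hx y hy hxy
    have h0 : ∑ m, (T m (inner ℝ (b m) x) - T m (inner ℝ (b m) y)) *
        (inner ℝ (b m) x - inner ℝ (b m) y) = 0 := by
      have h1 : inner ℝ (Ψ x - Ψ y) (x - y) = 0 := by rw [hxy, sub_self, inner_zero_left]
      rw [← h1, hΨ]
      simp only
      rw [← Finset.sum_sub_distrib, sum_inner]
      refine Finset.sum_congr rfl fun m _ => ?_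
      rw [← sub_smul, inner_smul_left, conj_trivial, inner_sub_right]
    have hnn : ∀ m, 0 ≤ (T m (inner ℝ (b m) x) - T m (inner ℝ (b m) y)) *
        (inner ℝ (b m) x - inner ℝ (b m) y) := by
      intro m
      rcases le_total (inner ℝ (b m) x : ℝ) (inner ℝ (b m) y) with h | h
      · exact mul_nonneg_of_nonpos_of_nonpos
          (sub_nonpos.2 ((hmono m).monotoneOn (hSI x hx m) (hSI y hy m) h)) (sub_nonpos.2 h)
      · exact mul_nonneg
          (sub_nonneg.2 ((hmono m).monotoneOn (hSI y hy m) (hSI x hx m) h)) (sub_nonneg.2 h)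
    have heq : ∀ m, (inner ℝ (b m) x : ℝ) = inner ℝ (b m) y := by
      intro m
      have h1 := (Finset.sum_eq_zero_iff_of_nonneg fun m _ => hnn m).1 h0 m (Finset.mem_univ m)
      rcases mul_eq_zero.1 h1 with h | h
      · exact (hmono m).injOn (hSI x hx m) (hSI y hy m) (sub_eq_zero.1 h)
      · exact sub_eq_zero.1 h
    have hz := hb (x - y)
    rw [Finset.sum_eq_zero fun m _ => by rw [inner_sub_right, heq m, sub_self]; simp] at hz
    exact sub_eq_zero.1 (norm_eq_zero.1 (pow_eq_zero_iff two_ne_zero |>.1 hz.symm))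
  calc _ ≤ ∫⁻ x in S, ENNReal.ofReal |(Ψ' x).det| *
          ENNReal.ofReal (Real.exp (-κ * ‖Ψ x‖ ^ 2)) := by
        refine setLIntegral_mono' hS fun x hx => ?_
        rw [← ENNReal.ofReal_mul (abs_nonneg _)]
        refine ENNReal.ofReal_le_ofReal ?_
        refine mul_le_mul ((prod_rpow_le_det_frameOperator hb
          fun m => hT' m _ (hSI x hx m)).trans (le_abs_self _)) ?_ (Real.exp_nonneg _)
          (abs_nonneg _)
        refine Real.exp_le_exp.2 ?_
        have := norm_sum_smul_sq_le_of_parseval hb fun m => T m (inner ℝ (b m) x)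
        simp only [neg_mul, neg_le_neg_iff]
        exact mul_le_mul_of_nonneg_left this hκ
    _ = ∫⁻ y in Ψ '' S, ENNReal.ofReal (Real.exp (-κ * ‖y‖ ^ 2)) :=
        (lintegral_image_eq_lintegral_abs_det_fderiv_mul volume hS hderiv hinj
          fun y => ENNReal.ofReal (Real.exp (-κ * ‖y‖ ^ 2))).symm
    _ ≤ _ := setLIntegral_le_lintegral _ _

end BrascampLieb

/-! ### Scalar transport estimate and the upper bound for the total mass. -/

/-- The difference of the sides has derivative `(w - 1)³ / w`, so its minimum is at `w = 1`. With
`w³ = 1 + u` this reads `u - log (1 + u) ≥ (9/2) (w - 1)²`, which is why a cube root is the right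
transport map. -/
theorem Real.log_le_cubic {w : ℝ} (hw : 0 < w) :
    Real.log w ≤ (w ^ 3 - 1) / 3 - 3 / 2 * (w - 1) ^ 2 := by
  set F : ℝ → ℝ := fun w => (w ^ 3 - 1) / 3 - 3 / 2 * (w - 1) ^ 2 - Real.log w with hF
  have hd : ∀ x, 0 < x → HasDerivAt F ((x - 1) ^ 3 / x) x := by
    intro x hx
    have h1 : HasDerivAt (fun x : ℝ => (x ^ 3 - 1) / 3) (x ^ 2) x := by
      have := ((hasDerivAt_pow 3 x).sub_const 1).div_const 3
      exact this.congr_deriv (by norm_num)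
    have h2 : HasDerivAt (fun x : ℝ => 3 / 2 * (x - 1) ^ 2) (3 * (x - 1)) x := by
      have := (((hasDerivAt_id x).sub_const 1).pow 2).const_mul (3 / 2)
      exact this.congr_deriv (by simp; ring)
    have h3 := (h1.sub h2).sub (Real.hasDerivAt_log hx.ne')
    exact h3.congr_deriv (by field_simp; ring)
  have hF1 : F 1 = 0 := by simp [hF]
  have key : 0 ≤ F w := by
    rw [← hF1]
    rcases le_total w 1 with h | h
    · refine antitoneOn_of_deriv_nonpos (convex_Ioc 0 1) (fun x hx =>
        (hd x hx.1).continuousAt.continuousWithinAt) (fun x hx => ?_) (fun x hx => ?_)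
        ⟨hw, h⟩ ⟨one_pos, le_rfl⟩ h
      · rw [interior_Ioc] at hx
        exact (hd x hx.1).differentiableAt.differentiableWithinAt
      · rw [interior_Ioc] at hx
        rw [(hd x hx.1).deriv]
        exact div_nonpos_of_nonpos_of_nonneg
          (Odd.pow_nonpos (by decide) (by linarith [hx.2])) hx.1.le
    · have hpos : ∀ x ∈ Set.Ici (1 : ℝ), 0 < x := fun x hx => lt_of_lt_of_le one_pos hx
      refine monotoneOn_of_deriv_nonneg (convex_Ici 1) (fun x hx =>
        (hd x (hpos x hx)).continuousAt.continuousWithinAt) (fun x hx => ?_) (fun x hx => ?_)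
        (Set.mem_Ici.2 le_rfl) h h
      · exact (hd x (hpos x (interior_subset hx))).differentiableAt.differentiableWithinAt
      · have h1 := hpos x (interior_subset hx)
        have h2 : (1 : ℝ) ≤ x := interior_subset hx
        rw [(hd x h1).deriv]
        exact div_nonneg (pow_nonneg (by linarith) 3) h1.le
  simp only [hF] at key
  linarith

/-- The shifted cube-root map, which nearly transports a Gamma density to a Gaussian. -/
noncomputable def cubeRootShift (a u : ℝ) : ℝ := 3 * (Real.exp (Real.log (1 + u) / 3) - 1) - a

theorem hasDerivAt_cubeRootShift (a : ℝ) {u : ℝ} (hu : -1 < u) :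
    HasDerivAt (cubeRootShift a) (Real.exp (-2 / 3 * Real.log (1 + u))) u := by
  have hpos : 0 < 1 + u := by linarith
  have h1 : HasDerivAt (fun u : ℝ => Real.log (1 + u) / 3) (1 / (1 + u) / 3) u :=
    (((hasDerivAt_id u).const_add 1).log hpos.ne').div_const 3
  have h2 := ((h1.exp.sub_const 1).const_mul 3).sub_const a
  have h3 : Real.exp (-2 / 3 * Real.log (1 + u)) * (1 + u) = Real.exp (Real.log (1 + u) / 3) := by
    conv_lhs => rw [← Real.exp_log hpos, Real.log_exp, ← Real.exp_add]
    congr 1; ring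
  exact h2.congr_deriv (by rw [← h3]; field_simp)

theorem strictMonoOn_cubeRootShift (a : ℝ) : StrictMonoOn (cubeRootShift a) (Set.Ioi (-1)) := by
  intro u hu v hv huv
  have h0 : 0 < 1 + u := by have := Set.mem_Ioi.1 hu; linarith
  have := Real.exp_lt_exp.2
    (div_lt_div_of_pos_right (Real.log_lt_log h0 (by linarith : 1 + u < 1 + v)) three_pos)
  simp only [cubeRootShift]
  linarith

/-- Put `w³ = 1 + u`. The Jacobian factor is `w ^ (-2c)`, at least `exp(-2c(w - 1))`. The shift `c /
(3k)` completes the square so that this linear term cancels, at the cost `exp(c² / (9k))`. -/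
theorem exp_neg_le_cubeRootShift {k c u : ℝ} (hk : 0 < k) (hc : 0 ≤ c) (hu : -1 < u) :
    Real.exp (-(2 * k) * (u - Real.log (1 + u))) ≤ Real.exp (c ^ 2 / (9 * k)) *
      (Real.exp (-2 / 3 * Real.log (1 + u)) ^ c *
        Real.exp (-k * cubeRootShift (c / (3 * k)) u ^ 2)) := by
  have hpos : 0 < 1 + u := by linarith
  rw [← Real.exp_mul, ← Real.exp_add, ← Real.exp_add, Real.exp_le_exp, cubeRootShift]
  set l := Real.log (1 + u) / 3 with hl
  set w := Real.exp l with hw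
  have hw3 : w ^ 3 = 1 + u := by
    rw [hw, ← Real.exp_nat_mul, hl]
    push_cast
    rw [mul_div_cancel₀ _ (by norm_num : (3 : ℝ) ≠ 0), Real.exp_log hpos]
  have hlog : Real.log (1 + u) = 3 * l := by rw [hl]; ring
  have h1 : l ≤ (w ^ 3 - 1) / 3 - 3 / 2 * (w - 1) ^ 2 := by
    have := Real.log_le_cubic (Real.exp_pos l)
    rwa [Real.log_exp] at this
  have h2 : l + 1 ≤ w := Real.add_one_le_exp l
  have hu' : u = w ^ 3 - 1 := by linarith
  rw [hlog, hu']
  have hexp : -k * (3 * (w - 1) - c / (3 * k)) ^ 2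
      = -(9 * k) * (w - 1) ^ 2 + 2 * c * (w - 1) - c ^ 2 / (9 * k) := by
    field_simp; ring
  rw [hexp]
  have h3 := mul_le_mul_of_nonneg_left h1 hk.le
  have h4 := mul_le_mul_of_nonneg_left h2 hc
  nlinarith

/-- Upper bound for the total mass of the logarithmic gas by its Gaussian approximation. -/
theorem lintegral_logGas_le {E ι₁ ι₂ : Type*} [NormedAddCommGroup E] [InnerProductSpace ℝ E]
    [Fintype ι₁] [Fintype ι₂] [FiniteDimensional ℝ E] [MeasurableSpace E] [BorelSpace E]
    {a : ι₁ → E} {b : ι₂ → E}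
    (hab : ∀ x, ∑ m, inner ℝ (a m) x ^ 2 + ∑ m, inner ℝ (b m) x ^ 2 = ‖x‖ ^ 2)
    {k : ℝ} (hk : 0 < k) :
    ∫⁻ x in {x : E | ∀ m, -1 < inner ℝ (b m) x}, ENNReal.ofReal
        (Real.exp (-k * ∑ m, inner ℝ (a m) x ^ 2
          - 2 * k * ∑ m, (inner ℝ (b m) x - Real.log (1 + inner ℝ (b m) x)))) ≤
      ENNReal.ofReal (Real.exp (Module.finrank ℝ E / (9 * k))) *
        ∫⁻ y : E, ENNReal.ofReal (Real.exp (-k * ‖y‖ ^ 2)) := by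
  set d : ι₁ ⊕ ι₂ → E := Sum.elim a b with hd
  have hpars : ∀ x, ∑ m, inner ℝ (d m) x ^ 2 = ‖x‖ ^ 2 := by
    intro x; rw [Fintype.sum_sum_type]; exact hab x
  have hle1 : ∀ m, ‖d m‖ ^ 2 ≤ 1 := by
    intro m
    have h1 : inner ℝ (d m) (d m) ^ 2 ≤ ‖d m‖ ^ 2 := by
      rw [← hpars (d m)]
      exact Finset.single_le_sum (f := fun n => inner ℝ (d n) (d m) ^ 2)
        (fun n _ => sq_nonneg _) (Finset.mem_univ m)
    rw [real_inner_self_eq_norm_sq] at h1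
    nlinarith [sq_nonneg (‖d m‖ ^ 2)]
  -- The costs add up to at most `N / (9k)` rather than growing with the number of pairs: frame
  -- vectors have norm at most one and their squared norms sum to the dimension.
  have hloss : ∑ m, (‖b m‖ ^ 2) ^ 2 / (9 * k) ≤ Module.finrank ℝ E / (9 * k) := by
    rw [← Finset.sum_div]
    refine div_le_div_of_nonneg_right ?_ (by positivity)
    rw [← sum_norm_sq_of_parseval hpars, Fintype.sum_sum_type]
    refine le_add_of_nonneg_of_le (Finset.sum_nonneg fun m _ => sq_nonneg _) ?_
    refine Finset.sum_le_sum fun m _ => ?_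
    have h1 := hle1 (Sum.inr m)
    simp only [hd, Sum.elim_inr] at h1 ⊢
    nlinarith [sq_nonneg ‖b m‖]
  have hSm : MeasurableSet {x : E | ∀ m, -1 < inner ℝ (b m) x} := by
    rw [Set.ofPred_forall]
    refine MeasurableSet.iInter fun m => measurableSet_lt measurable_const ?_
    exact (innerSL ℝ (b m)).continuous.measurable
  have key := lintegral_parseval_transport_le hpars hk.le hSm
    (I := Sum.elim (fun _ => Set.univ) fun _ => Set.Ioi (-1))
    (T := Sum.elim (fun _ u => u) fun m => cubeRootShift (‖b m‖ ^ 2 / (3 * k)))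
    (T' := Sum.elim (fun _ _ => 1) fun _ u => Real.exp (-2 / 3 * Real.log (1 + u)))
    (by
      rintro x hx (m | m)
      · trivial
      · exact hx m)
    (by
      rintro (m | m) u hu
      · exact hasDerivAt_id u
      · exact hasDerivAt_cubeRootShift _ hu)
    (by
      rintro (m | m) u hu
      · exact one_pos
      · exact Real.exp_pos _)
    (by
      rintro (m | m)
      · exact strictMono_id.strictMonoOn _
      · exact strictMonoOn_cubeRootShift _)
  refine le_trans ?_ (mul_le_mul_right key _)
  rw [← lintegral_const_mul' _ _ ENNReal.ofReal_ne_top]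
  refine setLIntegral_mono' hSm fun x hx => ?_
  rw [← ENNReal.ofReal_mul (Real.exp_nonneg _)]
  refine ENNReal.ofReal_le_ofReal ?_
  simp only [Fintype.prod_sum_type, Fintype.sum_sum_type, Sum.elim_inl, Sum.elim_inr, hd,
    Real.one_rpow, Finset.prod_const_one, one_mul]
  rw [mul_add, sub_eq_add_neg, Real.exp_add, Real.exp_add, ← neg_mul, Finset.mul_sum Finset.univ
    (fun m => inner ℝ (b m) x - Real.log (1 + inner ℝ (b m) x)), Real.exp_sum,
    Finset.mul_sum Finset.univ (fun m => cubeRootShift _ _ ^ 2), Real.exp_sum]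
  have hprod : ∏ m, Real.exp (-(2 * k) * (inner ℝ (b m) x - Real.log (1 + inner ℝ (b m) x))) ≤
      ∏ m, (Real.exp ((‖b m‖ ^ 2) ^ 2 / (9 * k)) *
        (Real.exp (-2 / 3 * Real.log (1 + inner ℝ (b m) x)) ^ (‖b m‖ ^ 2) *
          Real.exp (-k * cubeRootShift (‖b m‖ ^ 2 / (3 * k)) (inner ℝ (b m) x) ^ 2))) :=
    Finset.prod_le_prod (fun m _ => Real.exp_nonneg _) fun m _ =>
      exp_neg_le_cubeRootShift hk (sq_nonneg _) (hx m)
  rw [Finset.prod_mul_distrib, Finset.prod_mul_distrib] at hprod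
  have hE := Real.exp_le_exp.2 hloss
  rw [Real.exp_sum] at hE
  set P1 := ∏ m, Real.exp (-2 / 3 * Real.log (1 + inner ℝ (b m) x)) ^ (‖b m‖ ^ 2)
  set P2 := ∏ m, Real.exp (-k * cubeRootShift (‖b m‖ ^ 2 / (3 * k)) (inner ℝ (b m) x) ^ 2)
  have hP : 0 ≤ P1 * P2 := by positivity
  have hA := Real.exp_nonneg (-k * ∑ m, inner ℝ (a m) x ^ 2)
  calc _ ≤ Real.exp (-k * ∑ m, inner ℝ (a m) x ^ 2) *
        (Real.exp (Module.finrank ℝ E / (9 * k)) * (P1 * P2)) :=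
        mul_le_mul_of_nonneg_left (hprod.trans (mul_le_mul_of_nonneg_right hE hP)) hA
    _ = _ := by ring

/-! ### Gaussian integrals and the Gaussian tail. -/

theorem lintegral_exp_neg_sum_mul_sq {ι : Type*} [Fintype ι] {β : ι → ℝ} (hβ : ∀ l, 0 < β l) :
    ∫⁻ x : EuclideanSpace ℝ ι, ENNReal.ofReal (Real.exp (-∑ l, β l * x l ^ 2)) =
      ENNReal.ofReal (∏ l, √(Real.pi / β l)) := by
  have hprod : ∀ y : ι → ℝ, Real.exp (-∑ l, β l * y l ^ 2)
      = ∏ l, Real.exp (-β l * y l ^ 2) := by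
    intro y
    rw [← Real.exp_sum, ← Finset.sum_neg_distrib]
    simp only [neg_mul]
  have hmeas : Measurable fun y : ι → ℝ => ENNReal.ofReal (Real.exp (-∑ l, β l * y l ^ 2)) := by
    fun_prop
  have h1 := (PiLp.volume_preserving_ofLp ι).lintegral_comp hmeas
  rw [h1]
  simp_rw [hprod]
  rw [← ofReal_integral_eq_lintegral_ofReal]
  · rw [integral_fintype_prod_volume_eq_prod (fun l (y : ℝ) => Real.exp (-β l * y ^ 2))]
    simp_rw [integral_gaussian]
  · exact Integrable.fintype_prod (f := fun l (y : ℝ) => Real.exp (-β l * y ^ 2))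
      fun l => integrable_exp_neg_mul_sq (hβ l)
  · exact Filter.Eventually.of_forall fun y => Finset.prod_nonneg fun l _ => Real.exp_nonneg _

theorem lintegral_exp_neg_mul_norm_sq {N : ℕ} {k : ℝ} (hk : 0 < k) :
    ∫⁻ x : EuclideanSpace ℝ (Fin N), ENNReal.ofReal (Real.exp (-k * ‖x‖ ^ 2)) =
      ENNReal.ofReal (√(Real.pi / k) ^ N) := by
  have h := lintegral_exp_neg_sum_mul_sq (ι := Fin N) (β := fun _ => k) fun _ => hk
  rw [Finset.prod_const, Finset.card_univ, Fintype.card_fin] at h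
  rw [← h]
  refine lintegral_congr fun x => ?_
  rw [EuclideanSpace.norm_sq_eq, neg_mul, Finset.mul_sum]
  simp only [Real.norm_eq_abs, sq_abs]

/-- The factor `l = 0` is `1 - θ`; each later one is at least `l / (l + 1)`, and these telescope. -/
theorem div_le_prod_one_sub_div {θ : ℝ} (hθ1 : θ ≤ 1) (n : ℕ) :
    (1 - θ) / (n + 1) ≤ ∏ l ∈ Finset.range (n + 1), (1 - θ / ((l : ℝ) + 1)) := by
  induction n with
  | zero => simp
  | succ n ih =>
    rw [Finset.prod_range_succ]
    have h1 : ((n : ℝ) + 1) / (n + 2) ≤ 1 - θ / (((n + 1 : ℕ) : ℝ) + 1) := by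
      push_cast
      rw [div_le_iff₀ (by positivity), sub_mul, add_assoc]
      norm_num
      rw [div_mul_cancel₀ _ (by positivity)]
      linarith
    calc (1 - θ) / (((n + 1 : ℕ) : ℝ) + 1) = (1 - θ) / (n + 1) * (((n : ℝ) + 1) / (n + 2)) := by
          push_cast; field_simp; ring
      _ ≤ _ := mul_le_mul ih h1 (by positivity)
          ((div_nonneg (by linarith) (by positivity)).trans ih)

/-- Chernoff bound for the Gaussian with covariance eigenvalues proportional to `1 / (l + 1)`. -/
theorem lintegral_gaussian_tail_le {N : ℕ} (hN : 0 < N) {k R s : ℝ} (hk : 0 < k) (hs : 0 ≤ s)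
    (hR : 2 * k * R = s) :
    ∫⁻ x in {x : EuclideanSpace ℝ (Fin N) | R < ∑ l : Fin N, x l ^ 2 / ((l : ℝ) + 1)},
        ENNReal.ofReal (Real.exp (-k * ‖x‖ ^ 2)) ≤
      ENNReal.ofReal (√(Real.exp 1) * √(N * (s + 1)) * Real.exp (-s / 2)) *
        ∫⁻ x : EuclideanSpace ℝ (Fin N), ENNReal.ofReal (Real.exp (-k * ‖x‖ ^ 2)) := by
  -- With this Chernoff parameter `s (1 - θ) = θ ≤ 1`, so the exponential loses only `√e` against
  -- `exp(-s/2)`, while the determinant costs at most `√(N (s + 1))`.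
  set θ := s / (s + 1) with hθ
  have hθ0 : 0 ≤ θ := by positivity
  have hθ' : 1 - θ = 1 / (s + 1) := by rw [hθ]; field_simp; ring
  have hθ1 : θ < 1 := by have : 0 < 1 / (s + 1) := by positivity
                         linarith
  have hpos : ∀ l : Fin N, 0 < 1 - θ / ((l : ℝ) + 1) := by
    intro l
    rw [sub_pos, div_lt_one (by positivity)]
    have : (0 : ℝ) ≤ l := by positivity
    linarith
  have hm : MeasurableSet
      {x : EuclideanSpace ℝ (Fin N) | R < ∑ l : Fin N, x l ^ 2 / ((l : ℝ) + 1)} :=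
    measurableSet_lt measurable_const (by fun_prop)
  have hprod : ∏ l : Fin N, √(Real.pi / (k * (1 - θ / ((l : ℝ) + 1))))
      ≤ √(N * (s + 1)) * √(Real.pi / k) ^ N := by
    have h1 : ∀ l : Fin N, √(Real.pi / (k * (1 - θ / ((l : ℝ) + 1))))
        = √(1 / (1 - θ / ((l : ℝ) + 1))) * √(Real.pi / k) := by
      intro l
      rw [← Real.sqrt_mul (one_div_pos.2 (hpos l)).le]
      congr 1; rw [div_mul_div_comm, one_mul, mul_comm k]
    rw [Finset.prod_congr rfl fun l _ => h1 l, Finset.prod_mul_distrib, Finset.prod_const,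
      Finset.card_univ, Fintype.card_fin]
    refine mul_le_mul_of_nonneg_right ?_ (by positivity)
    rw [← Real.sqrt_prod _ fun l _ => (one_div_pos.2 (hpos l)).le]
    refine Real.sqrt_le_sqrt ?_
    rw [Finset.prod_div_distrib, Finset.prod_const_one]
    obtain ⟨n, rfl⟩ : ∃ n, N = n + 1 := ⟨N - 1, by omega⟩
    have h2 := div_le_prod_one_sub_div hθ1.le n
    rw [← Fin.prod_univ_eq_prod_range (fun l => 1 - θ / ((l : ℝ) + 1)) (n + 1)] at h2
    refine (one_div_le_one_div_of_le (div_pos (by linarith) (by positivity)) h2).trans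
      (le_of_eq ?_)
    rw [hθ']; push_cast; field_simp
  calc _ ≤ ∫⁻ x in {x : EuclideanSpace ℝ (Fin N) | R < ∑ l : Fin N, x l ^ 2 / ((l : ℝ) + 1)},
        ENNReal.ofReal (Real.exp (-(k * θ * R))) * ENNReal.ofReal
          (Real.exp (-∑ l : Fin N, k * (1 - θ / ((l : ℝ) + 1)) * x l ^ 2)) := by
        refine setLIntegral_mono' hm fun x hx => ?_
        rw [← ENNReal.ofReal_mul (Real.exp_nonneg _), ← Real.exp_add]
        refine ENNReal.ofReal_le_ofReal (Real.exp_le_exp.2 ?_)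
        have h1 : ∑ l : Fin N, k * (1 - θ / ((l : ℝ) + 1)) * x l ^ 2
            = k * ‖x‖ ^ 2 - k * θ * ∑ l : Fin N, x l ^ 2 / ((l : ℝ) + 1) := by
          rw [EuclideanSpace.norm_sq_eq, Finset.mul_sum, Finset.mul_sum, ← Finset.sum_sub_distrib]
          refine Finset.sum_congr rfl fun l _ => ?_
          rw [Real.norm_eq_abs, sq_abs]; ring
        have h0 : R < ∑ l : Fin N, x l ^ 2 / ((l : ℝ) + 1) := hx
        have h2 := mul_le_mul_of_nonneg_left h0.le (mul_nonneg hk.le hθ0)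
        rw [h1]
        linarith
    _ ≤ ENNReal.ofReal (Real.exp (-(k * θ * R))) * ∫⁻ x : EuclideanSpace ℝ (Fin N),
          ENNReal.ofReal (Real.exp (-∑ l : Fin N, k * (1 - θ / ((l : ℝ) + 1)) * x l ^ 2)) := by
        rw [lintegral_const_mul' _ _ ENNReal.ofReal_ne_top]
        exact mul_le_mul_right (setLIntegral_le_lintegral _ _) _
    _ ≤ _ := by
        rw [lintegral_exp_neg_sum_mul_sq fun l => mul_pos hk (hpos l),
          lintegral_exp_neg_mul_norm_sq hk, ← ENNReal.ofReal_mul (Real.exp_nonneg _),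
          ← ENNReal.ofReal_mul (by positivity)]
        refine ENNReal.ofReal_le_ofReal ?_
        have h1 : Real.exp (-(k * θ * R)) ≤ √(Real.exp 1) * Real.exp (-s / 2) := by
          rw [Real.sqrt_eq_rpow, ← Real.exp_mul, ← Real.exp_add, Real.exp_le_exp]
          have h2 : k * θ * R = s / 2 * θ := by rw [← hR]; ring
          have h3 : s * (1 - θ) = θ := by rw [hθ', hθ]; ring
          rw [h2]
          linarith
        calc _ ≤ (√(Real.exp 1) * Real.exp (-s / 2)) *
              (√(N * (s + 1)) * √(Real.pi / k) ^ N) :=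
              mul_le_mul h1 hprod (Finset.prod_nonneg fun l _ => Real.sqrt_nonneg _)
                (by positivity)
          _ = _ := by ring

/-! ### The ensemble in displacement coordinates around the Hermite zeros. -/

/-- The density of the rescaled ensemble relative to its value at the Hermite zeros. -/
noncomputable def logGasDensity {N : ℕ} (k : ℝ) (h : EuclideanSpace ℝ (Fin N)) : ℝ :=
  Real.exp (-k * ‖h‖ ^ 2 - 2 * k * ∑ p : IncPair N, (relGap p h - Real.log (1 + relGap p h)))

theorem logGasDensity_nonneg {N : ℕ} (k : ℝ) (h : EuclideanSpace ℝ (Fin N)) :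
    0 ≤ logGasDensity k h :=
  Real.exp_nonneg _

theorem measurable_logGasDensity {N : ℕ} (k : ℝ) :
    Measurable (logGasDensity k : EuclideanSpace ℝ (Fin N) → ℝ) := by
  unfold logGasDensity
  fun_prop

/-- Expanding `‖z + h‖²` produces `2⟨z, h⟩`, which by criticality is twice the sum of the relative
gaps; this supplies the linear term in `u - log (1 + u)`. -/
theorem hermiteWeight_smul_add {N : ℕ} (hN : 0 < N) {k : ℝ} (hk : 0 < k)
    (h : EuclideanSpace ℝ (Fin N)) (hh : ∀ p : IncPair N, -1 < relGap p h) :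
    hermiteWeight N k (√(2 * k) • (hermiteZeros N + h)) =
      hermiteWeight N k (√(2 * k) • hermiteZeros N) * logGasDensity k h := by
  have hsq : √(2 * k) ^ 2 = 2 * k := Real.sq_sqrt (by positivity)
  have hsp : 0 < √(2 * k) := Real.sqrt_pos.2 (by positivity)
  have hn : ∀ y : EuclideanSpace ℝ (Fin N), -‖√(2 * k) • y‖ ^ 2 / 2 = -k * ‖y‖ ^ 2 := by
    intro y
    rw [norm_smul, mul_pow, Real.norm_eq_abs, sq_abs, hsq]; ring
  have hfac : ∀ p : IncPair N,
      ((√(2 * k) • (hermiteZeros N + h)) p.1.1 - (√(2 * k) • (hermiteZeros N + h)) p.1.2)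
          ^ (2 * k)
        = ((√(2 * k) • hermiteZeros N) p.1.1 - (√(2 * k) • hermiteZeros N) p.1.2) ^ (2 * k)
          * Real.exp (2 * k * Real.log (1 + relGap p h)) := by
    intro p
    have hz := hermiteZeros_sub_pos p
    have hu : 0 < 1 + relGap p h := by linarith [hh p]
    have h1 : (√(2 * k) • (hermiteZeros N + h)) p.1.1 - (√(2 * k) • (hermiteZeros N + h)) p.1.2
        = ((√(2 * k) • hermiteZeros N) p.1.1 - (√(2 * k) • hermiteZeros N) p.1.2)
          * (1 + relGap p h) := by
      rw [relGap_apply]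
      simp only [PiLp.smul_apply, PiLp.add_apply, smul_eq_mul]
      field_simp
      ring
    have h2 : 0 ≤ (√(2 * k) • hermiteZeros N) p.1.1 - (√(2 * k) • hermiteZeros N) p.1.2 := by
      simp only [PiLp.smul_apply, smul_eq_mul, ← mul_sub]
      positivity
    rw [h1, Real.mul_rpow h2 hu.le, Real.rpow_def_of_pos hu, mul_comm (2 * k) (Real.log _)]
  unfold hermiteWeight logGasDensity
  rw [← prod_incPair (fun i j => ((√(2 * k) • (hermiteZeros N + h)) i
      - (√(2 * k) • (hermiteZeros N + h)) j) ^ (2 * k)),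
    ← prod_incPair (fun i j => ((√(2 * k) • hermiteZeros N) i
      - (√(2 * k) • hermiteZeros N) j) ^ (2 * k)),
    Finset.prod_congr rfl fun p _ => hfac p, Finset.prod_mul_distrib, ← Real.exp_sum, hn, hn,
    norm_add_sq_real, inner_hermiteZeros_eq_sum_relGap hN, ← Finset.mul_sum,
    Finset.sum_sub_distrib]
  set A := ∏ p : IncPair N,
    ((√(2 * k) • hermiteZeros N) p.1.1 - (√(2 * k) • hermiteZeros N) p.1.2) ^ (2 * k)
  rw [mul_left_comm, ← Real.exp_add, mul_comm (Real.exp _) A, mul_assoc A, ← Real.exp_add]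
  congr 2
  ring

/-- A gap `≤ -1` reverses or merges two coordinates; the chamber allows only merging, where the
factor `0 ^ (2k)` vanishes. Hence only the open cell carries mass. -/
theorem hermiteWeight_eq_zero_of_relGap_le {N : ℕ} {k : ℝ} (hk : 0 < k)
    (h : EuclideanSpace ℝ (Fin N)) (hc : √(2 * k) • (hermiteZeros N + h) ∈ weylChamberA N)
    (hh : ¬ ∀ p : IncPair N, -1 < relGap p h) :
    hermiteWeight N k (√(2 * k) • (hermiteZeros N + h)) = 0 := by
  push Not at hh
  obtain ⟨p, hp⟩ := hh
  have hz := hermiteZeros_sub_pos p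
  have hsp : 0 < √(2 * k) := Real.sqrt_pos.2 (by positivity)
  have h1 := hc p.1.1 p.1.2 p.2.le
  rw [relGap_apply, div_le_iff₀ hz] at hp
  have h2 : (√(2 * k) • (hermiteZeros N + h)) p.1.1 ≤ (√(2 * k) • (hermiteZeros N + h)) p.1.2 := by
    simp only [PiLp.smul_apply, PiLp.add_apply, smul_eq_mul]
    exact mul_le_mul_of_nonneg_left (by linarith) hsp.le
  unfold hermiteWeight
  rw [← prod_incPair (fun i j => ((√(2 * k) • (hermiteZeros N + h)) i
      - (√(2 * k) • (hermiteZeros N + h)) j) ^ (2 * k))]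
  refine mul_eq_zero_of_right _ (Finset.prod_eq_zero (Finset.mem_univ p) ?_)
  rw [sub_eq_zero.2 (le_antisymm h2 h1), Real.zero_rpow (by positivity)]

theorem smul_add_mem_weylChamberA {N : ℕ} (k : ℝ)
    (h : EuclideanSpace ℝ (Fin N)) (hh : ∀ p : IncPair N, -1 < relGap p h) :
    √(2 * k) • (hermiteZeros N + h) ∈ weylChamberA N := by
  intro i j hij
  rcases hij.eq_or_lt with rfl | hlt
  · exact le_rfl
  · have h1 := hh ⟨(i, j), hlt⟩
    have hz := hermiteZeros_sub_pos (⟨(i, j), hlt⟩ : IncPair N)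
    rw [relGap_apply, lt_div_iff₀ hz] at h1
    simp only [PiLp.smul_apply, PiLp.add_apply, smul_eq_mul] at h1 ⊢
    exact mul_le_mul_of_nonneg_left (by linarith) (Real.sqrt_nonneg _)

/-- Displacements for which the order of the Hermite zeros is kept. -/
def openCell (N : ℕ) : Set (EuclideanSpace ℝ (Fin N)) := {h | ∀ p : IncPair N, -1 < relGap p h}

theorem measurableSet_openCell (N : ℕ) : MeasurableSet (openCell N) := by
  unfold openCell
  rw [Set.ofPred_forall]
  exact MeasurableSet.iInter fun p => measurableSet_lt measurable_const
    (relGap p).continuous.measurable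

theorem measurableSet_weylChamberA (N : ℕ) : MeasurableSet (weylChamberA N) := by
  unfold weylChamberA
  simp only [Set.ofPred_forall]
  exact MeasurableSet.iInter fun i => MeasurableSet.iInter fun j => MeasurableSet.iInter fun _ =>
    measurableSet_le (by fun_prop) (by fun_prop)

/-- From `log y ≥ 1 - 1/y` at `y = 1 - x`; the constant `4/3` bounds `1 / (1 - x)` for `x ≤ 1/4`. -/
theorem neg_sub_le_log_one_sub {x : ℝ} (hx : x ≤ 1 / 4) :
    -x - 4 / 3 * x ^ 2 ≤ Real.log (1 - x) := by
  have hpos : 0 < 1 - x := by linarith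
  refine le_trans ?_ (Real.one_sub_inv_le_log_of_pos hpos)
  rw [le_sub_iff_add_le, ← le_sub_iff_add_le', inv_le_iff_one_le_mul₀ hpos]
  nlinarith [mul_nonneg (sq_nonneg x) (by linarith : 0 ≤ 1 / 4 - x)]

/-! ### Two-sided mass estimates in whitened coordinates. -/

section Whitened

variable {N : ℕ} {L : EuclideanSpace ℝ (Fin N) ≃L[ℝ] EuclideanSpace ℝ (Fin N)}

/-- The Riesz representatives of the coordinates and of the relative gaps, pulled back by `L`,
together form a Parseval frame. -/
theorem setLIntegral_logGasDensity_le
    (hL : ∀ x, ‖L x‖ ^ 2 + ∑ p : IncPair N, relGap p (L x) ^ 2 = ‖x‖ ^ 2)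
    {k : ℝ} (hk : 0 < k) :
    ∫⁻ x in L ⁻¹' openCell N, ENNReal.ofReal (logGasDensity k (L x)) ≤
      ENNReal.ofReal (Real.exp (N / (9 * k))) *
        ∫⁻ y : EuclideanSpace ℝ (Fin N), ENNReal.ofReal (Real.exp (-k * ‖y‖ ^ 2)) := by
  set a : Fin N → EuclideanSpace ℝ (Fin N) := fun l => (InnerProductSpace.toDual ℝ _).symm
    ((EuclideanSpace.proj l : EuclideanSpace ℝ (Fin N) →L[ℝ] ℝ).comp
      (L : EuclideanSpace ℝ (Fin N) →L[ℝ] EuclideanSpace ℝ (Fin N)))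
  set b : IncPair N → EuclideanSpace ℝ (Fin N) := fun p => (InnerProductSpace.toDual ℝ _).symm
    ((relGap p).comp (L : EuclideanSpace ℝ (Fin N) →L[ℝ] EuclideanSpace ℝ (Fin N)))
  have ha : ∀ l x, inner ℝ (a l) x = L x l := fun l x => InnerProductSpace.toDual_symm_apply
  have hb : ∀ p x, inner ℝ (b p) x = relGap p (L x) := fun p x =>
    InnerProductSpace.toDual_symm_apply
  have hnorm : ∀ x, ∑ l, inner ℝ (a l) x ^ 2 = ‖L x‖ ^ 2 := by
    intro x
    simp only [ha, EuclideanSpace.norm_sq_eq, Real.norm_eq_abs, sq_abs]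
  have key := lintegral_logGas_le (a := a) (b := b)
    (fun x => by simp only [hnorm, hb]; exact hL x) hk
  simp only [hnorm, hb, finrank_euclideanSpace, Fintype.card_fin] at key
  exact key

/-- Lower bound for the mass near the Hermite zeros, by symmetrization. -/
theorem le_setLIntegral_logGasDensity
    (hL : ∀ x, ‖L x‖ ^ 2 + ∑ p : IncPair N, relGap p (L x) ^ 2 = ‖x‖ ^ 2)
    (hL' : ∀ x, ‖L x‖ ^ 2 = ∑ l : Fin N, x l ^ 2 / ((l : ℝ) + 1))
    {k R : ℝ} (hk : 0 < k) (hR : N * R ≤ 1 / 4) :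
    {x | ‖L x‖ ^ 2 ≤ R} ⊆ L ⁻¹' openCell N ∧
    ENNReal.ofReal (Real.exp (-(4 / 3 * k * (N * R) ^ 2))) *
        ∫⁻ x in {x | ‖L x‖ ^ 2 ≤ R}, ENNReal.ofReal (Real.exp (-k * ‖x‖ ^ 2)) ≤
      ∫⁻ x in {x | ‖L x‖ ^ 2 ≤ R}, ENNReal.ofReal (logGasDensity k (L x)) := by
  set B := {x | ‖L x‖ ^ 2 ≤ R} with hB
  have hBm : MeasurableSet B := measurableSet_le (by fun_prop) measurable_const
  have hsum : ∀ x ∈ B, ∑ p : IncPair N, relGap p (L x) ^ 2 ≤ N * R := by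
    intro x hx
    have hx' : ‖L x‖ ^ 2 ≤ R := hx
    -- The largest Hessian eigenvalue is `N`.
    have h1 : ‖x‖ ^ 2 ≤ N * ‖L x‖ ^ 2 := by
      rw [hL', EuclideanSpace.norm_sq_eq, Finset.mul_sum]
      refine Finset.sum_le_sum fun l _ => ?_
      have h2 : (l : ℝ) + 1 ≤ N := by exact_mod_cast l.2
      rw [Real.norm_eq_abs, sq_abs, mul_div_assoc', le_div_iff₀ (by positivity), mul_comm]
      exact mul_le_mul_of_nonneg_right h2 (sq_nonneg _)
    have h3 : (N : ℝ) * ‖L x‖ ^ 2 ≤ N * R := mul_le_mul_of_nonneg_left hx' (by positivity)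
    have h4 := hL x
    nlinarith [sq_nonneg ‖L x‖]
  have hsq : ∀ x ∈ B, ∀ p : IncPair N, relGap p (L x) ^ 2 ≤ N * R := fun x hx p =>
    (Finset.single_le_sum (f := fun p : IncPair N => relGap p (L x) ^ 2)
      (fun q _ => sq_nonneg _) (Finset.mem_univ p)).trans (hsum x hx)
  have habs : ∀ x ∈ B, ∀ p : IncPair N, |relGap p (L x)| ≤ 1 / 2 := by
    intro x hx p
    refine abs_le_of_sq_le_sq ?_ (by norm_num)
    linarith [hsq x hx p]
  refine ⟨fun x hx p => by linarith [(abs_le.1 (habs x hx p)).1], ?_⟩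
  -- By AM–GM the sum of the densities at `±x` is at least twice their geometric mean, where the
  -- linear terms cancel and the logarithms combine to `log (1 - u²)`.
  have hpoint : ∀ x ∈ B, 2 * (Real.exp (-(4 / 3 * k * (N * R) ^ 2)) * Real.exp (-k * ‖x‖ ^ 2)) ≤
      logGasDensity k (L x) + logGasDensity k (L (-x)) := by
    intro x hx
    set S := ∑ p : IncPair N, Real.log (1 - relGap p (L x) ^ 2) with hS
    have hlog : ∑ p : IncPair N, Real.log (1 + relGap p (L x))
        + ∑ p : IncPair N, Real.log (1 + -relGap p (L x)) = S := by
      rw [← Finset.sum_add_distrib]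
      refine Finset.sum_congr rfl fun p _ => ?_
      have h1 := abs_le.1 (habs x hx p)
      rw [← Real.log_mul (by linarith [h1.1]) (by linarith [h1.2])]
      congr 1; ring
    have hSle : -∑ p : IncPair N, relGap p (L x) ^ 2 - 4 / 3 * (N * R) ^ 2 ≤ S := by
      have h1 : ∑ p : IncPair N, (-relGap p (L x) ^ 2 - 4 / 3 * (relGap p (L x) ^ 2) ^ 2) ≤ S :=
        Finset.sum_le_sum fun p _ => neg_sub_le_log_one_sub ((hsq x hx p).trans hR)
      have h2 : ∑ p : IncPair N, (relGap p (L x) ^ 2) ^ 2 ≤ (N * R) ^ 2 := by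
        calc ∑ p : IncPair N, (relGap p (L x) ^ 2) ^ 2
            ≤ ∑ p : IncPair N, N * R * relGap p (L x) ^ 2 := by
              refine Finset.sum_le_sum fun p _ => ?_
              rw [sq]
              exact mul_le_mul_of_nonneg_right (hsq x hx p) (sq_nonneg _)
          _ ≤ (N * R) ^ 2 := by
              rw [← Finset.mul_sum, sq]
              refine mul_le_mul_of_nonneg_left (hsum x hx) ?_
              exact (Finset.sum_nonneg fun p _ => sq_nonneg _).trans (hsum x hx)
      rw [Finset.sum_sub_distrib, Finset.sum_neg_distrib, ← Finset.mul_sum] at h1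
      linarith
    rw [← Real.exp_add]
    unfold logGasDensity
    simp only [map_neg, norm_neg, Finset.sum_sub_distrib, Finset.sum_neg_distrib]
    set α := -k * ‖L x‖ ^ 2 - 2 * k * (∑ p : IncPair N, relGap p (L x)
      - ∑ p : IncPair N, Real.log (1 + relGap p (L x))) with hα
    set β := -k * ‖L x‖ ^ 2 - 2 * k * (-∑ p : IncPair N, relGap p (L x)
      - ∑ p : IncPair N, Real.log (1 + -relGap p (L x))) with hβ
    have hmid : 2 * Real.exp ((α + β) / 2) ≤ Real.exp α + Real.exp β := by
      have h1 : Real.exp α = Real.exp (α / 2) ^ 2 := by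
        rw [← Real.exp_nat_mul]; congr 1; push_cast; ring
      have h2 : Real.exp β = Real.exp (β / 2) ^ 2 := by
        rw [← Real.exp_nat_mul]; congr 1; push_cast; ring
      rw [add_div, Real.exp_add, h1, h2]
      nlinarith [sq_nonneg (Real.exp (α / 2) - Real.exp (β / 2))]
    refine le_trans (mul_le_mul_of_nonneg_left (Real.exp_le_exp.2 ?_) two_pos.le) hmid
    have hαβ : (α + β) / 2 = -k * ‖L x‖ ^ 2 + k * S := by
      rw [← hlog, hα, hβ]; ring
    rw [hαβ, ← hL x]
    nlinarith [mul_le_mul_of_nonneg_left hSle hk.le]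
  have hmeas : Measurable fun x => ENNReal.ofReal (logGasDensity k (L x)) :=
    ((measurable_logGasDensity k).comp L.continuous.measurable).ennreal_ofReal
  have hneg : ∫⁻ x in B, ENNReal.ofReal (logGasDensity k (L (-x)))
      = ∫⁻ x in B, ENNReal.ofReal (logGasDensity k (L x)) := by
    have h := (Measure.measurePreserving_neg
      (volume : Measure (EuclideanSpace ℝ (Fin N)))).setLIntegral_comp_preimage hBm hmeas
    have hpre : Neg.neg ⁻¹' B = B := by
      ext x; simp [hB]
    rwa [hpre] at h
  rw [← ENNReal.mul_le_mul_iff_right (a := 2) two_ne_zero ENNReal.ofNat_ne_top]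
  calc _ = ∫⁻ x in B, ENNReal.ofReal
        (2 * (Real.exp (-(4 / 3 * k * (N * R) ^ 2)) * Real.exp (-k * ‖x‖ ^ 2))) := by
        rw [← lintegral_const_mul' _ _ ENNReal.ofReal_ne_top,
          ← lintegral_const_mul' _ _ ENNReal.ofNat_ne_top]
        refine lintegral_congr fun x => ?_
        rw [ENNReal.ofReal_mul two_pos.le, ENNReal.ofReal_mul (Real.exp_nonneg _),
          ENNReal.ofReal_ofNat]
    _ ≤ ∫⁻ x in B, (ENNReal.ofReal (logGasDensity k (L x))
          + ENNReal.ofReal (logGasDensity k (L (-x)))) := by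
        refine setLIntegral_mono' hBm fun x hx => ?_
        rw [← ENNReal.ofReal_add (logGasDensity_nonneg _ _) (logGasDensity_nonneg _ _)]
        exact ENNReal.ofReal_le_ofReal (hpoint x hx)
    _ = _ := by
        rw [lintegral_add_left hmeas, hneg, two_mul]

/-- The ensemble in whitened coordinates. -/
theorem exists_hermiteEnsemble_image_eq (hN : 0 < N) {k : ℝ} (hk : 0 < k)
    (L : EuclideanSpace ℝ (Fin N) ≃L[ℝ] EuclideanSpace ℝ (Fin N)) :
    ∃ K : ENNReal, ∀ S : Set (EuclideanSpace ℝ (Fin N)), MeasurableSet S →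
      hermiteEnsemble N k ((fun x => √(2 * k) • (hermiteZeros N + L x)) '' S) =
        K * ∫⁻ x in S ∩ L ⁻¹' openCell N, ENNReal.ofReal (logGasDensity k (L x)) := by
  have hsp : 0 < √(2 * k) := Real.sqrt_pos.2 (by positivity)
  set Θ : EuclideanSpace ℝ (Fin N) → EuclideanSpace ℝ (Fin N) :=
    fun x => √(2 * k) • (hermiteZeros N + L x) with hΘ
  set D : EuclideanSpace ℝ (Fin N) →L[ℝ] EuclideanSpace ℝ (Fin N) :=
    √(2 * k) • (L : EuclideanSpace ℝ (Fin N) →L[ℝ] EuclideanSpace ℝ (Fin N)) with hD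
  have hderiv : ∀ x, HasFDerivAt Θ D x := fun x => by
    have h1 : HasFDerivAt (fun x => hermiteZeros N + L x)
        (L : EuclideanSpace ℝ (Fin N) →L[ℝ] EuclideanSpace ℝ (Fin N)) x :=
      L.hasFDerivAt.const_add _
    exact h1.const_smul (√(2 * k))
  have hinj : Function.Injective Θ := by
    intro x y hxy
    have h1 := smul_right_injective _ hsp.ne' hxy
    exact L.injective (add_left_cancel h1)
  -- The constant collects the Jacobian, the normalization and the weight at the zeros. Only its
  -- independence of `S` matters.
  refine ⟨ENNReal.ofReal |D.det| * ENNReal.ofReal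
    (hermiteConst N k * hermiteWeight N k (√(2 * k) • hermiteZeros N)), fun S hS => ?_⟩
  have himg : MeasurableSet (Θ '' S) :=
    measurable_image_of_fderivWithin hS (fun x _ => (hderiv x).hasFDerivWithinAt) hinj.injOn
  have hUm : MeasurableSet (L ⁻¹' openCell N) :=
    L.continuous.measurable (measurableSet_openCell N)
  rw [hermiteEnsemble, withDensity_apply _ himg, Measure.restrict_restrict himg,
    Set.inter_comm (Θ '' S), ← Measure.restrict_restrict (measurableSet_weylChamberA N),
    ← lintegral_indicator (measurableSet_weylChamberA N),
    lintegral_image_eq_lintegral_abs_det_fderiv_mul volume hS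
      (fun x _ => (hderiv x).hasFDerivWithinAt) hinj.injOn,
    Set.inter_comm S, ← Measure.restrict_restrict hUm, ← lintegral_indicator hUm,
    mul_assoc, ← lintegral_const_mul' _ _ ENNReal.ofReal_ne_top,
    ← lintegral_const_mul' _ _ ENNReal.ofReal_ne_top]
  refine lintegral_congr fun x => ?_
  congr 1
  by_cases hx : L x ∈ openCell N
  · rw [Set.indicator_of_mem (smul_add_mem_weylChamberA k (L x) hx),
      Set.indicator_of_mem (show x ∈ L ⁻¹' openCell N from hx),
      hermiteWeight_smul_add hN hk (L x) hx, ← mul_assoc, ENNReal.ofReal_mul' (logGasDensity_nonneg _ _)]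
  · rw [Set.indicator_of_notMem (show x ∉ L ⁻¹' openCell N from hx), mul_zero]
    by_cases hc : Θ x ∈ weylChamberA N
    · rw [Set.indicator_of_mem hc, hermiteWeight_eq_zero_of_relGap_le hk (L x) hc hx, mul_zero,
        ENNReal.ofReal_zero]
    · rw [Set.indicator_of_notMem hc]

end Whitened

/-! ### Concentration and the explicit tail bound. -/

/-- With `τ` the Gaussian tail bound and `E` the lower-bound exponent, the ball has probability at
least `exp(-E - N/(9k)) (1 - τ)` when `τ ≤ 1`. Then `exp(-a) ≥ 1 - a` makes the three errors
additive. -/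
theorem hermiteEnsemble_concentration {N : ℕ} (hN : 0 < N) {k R : ℝ} (hk : 0 < k) (hR0 : 0 ≤ R)
    (hR : N * R ≤ 1 / 4) [IsProbabilityMeasure (hermiteEnsemble N k)] :
    (hermiteEnsemble N k).real {y | R < ‖(1 / √(2 * k)) • y - hermiteZeros N‖ ^ 2} ≤
      4 / 3 * k * (N * R) ^ 2 + N / (9 * k)
        + √(Real.exp 1) * √(N * (2 * k * R + 1)) * Real.exp (-(2 * k * R) / 2) := by
  obtain ⟨L, hLL⟩ := exists_hessian_whitening N
  have hL' := fun x => (hLL x).1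
  have hL := fun x => (hLL x).2
  obtain ⟨K, hK⟩ := exists_hermiteEnsemble_image_eq hN hk L
  have hsp : √(2 * k) ≠ 0 := (Real.sqrt_pos.2 (by positivity)).ne'
  set μ := hermiteEnsemble N k with hμ
  set Θ : EuclideanSpace ℝ (Fin N) → EuclideanSpace ℝ (Fin N) :=
    fun x => √(2 * k) • (hermiteZeros N + L x) with hΘ
  set B := {x | ‖L x‖ ^ 2 ≤ R} with hB
  set G : EuclideanSpace ℝ (Fin N) → ENNReal :=
    fun x => ENNReal.ofReal (Real.exp (-k * ‖x‖ ^ 2)) with hG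
  set g := ∫⁻ x, G x with hg
  set E := 4 / 3 * k * (N * R) ^ 2 with hE
  set τ := √(Real.exp 1) * √(N * (2 * k * R + 1)) * Real.exp (-(2 * k * R) / 2) with hτ
  have hτ0 : 0 ≤ τ := by positivity
  have hE0 : 0 ≤ E := by positivity
  have hBm : MeasurableSet B := measurableSet_le (by fun_prop) measurable_const
  have hres : ∀ x, (1 / √(2 * k)) • Θ x - hermiteZeros N = L x := by
    intro x
    rw [hΘ]
    simp only [smul_smul, one_div_mul_cancel hsp, one_smul, add_sub_cancel_left]
  have himg : Θ '' B = {y | R < ‖(1 / √(2 * k)) • y - hermiteZeros N‖ ^ 2}ᶜ := by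
    ext y
    simp only [Set.mem_image, Set.mem_compl_iff, Set.mem_ofPred_eq, not_lt]
    constructor
    · rintro ⟨x, hx, rfl⟩
      rw [hres]; exact hx
    · intro hy
      have h1 : Θ (L.symm ((1 / √(2 * k)) • y - hermiteZeros N)) = y := by
        rw [hΘ]
        simp only [ContinuousLinearEquiv.apply_symm_apply, add_sub_cancel, smul_smul,
          mul_one_div_cancel hsp, one_smul]
      exact ⟨_, by rw [hB]; simpa using hy, h1⟩
  have hsurj : Θ '' Set.univ = Set.univ := by
    rw [Set.image_univ, Set.range_eq_univ]
    intro y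
    refine ⟨L.symm ((1 / √(2 * k)) • y - hermiteZeros N), ?_⟩
    rw [hΘ]
    simp only [ContinuousLinearEquiv.apply_symm_apply, add_sub_cancel, smul_smul,
      mul_one_div_cancel hsp, one_smul]
  have hevent : MeasurableSet {y | R < ‖(1 / √(2 * k)) • y - hermiteZeros N‖ ^ 2} :=
    measurableSet_lt measurable_const (by fun_prop)
  obtain ⟨hBU, hlow⟩ := le_setLIntegral_logGasDensity hL hL' hk hR
  have hup := setLIntegral_logGasDensity_le hL hk
  have htot : 1 = K * ∫⁻ x in L ⁻¹' openCell N, ENNReal.ofReal (logGasDensity k (L x)) := by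
    have h := hK Set.univ MeasurableSet.univ
    rwa [hsurj, measure_univ, Set.univ_inter] at h
  have hball : μ (Θ '' B) = K * ∫⁻ x in B, ENNReal.ofReal (logGasDensity k (L x)) := by
    have h := hK B hBm
    rwa [Set.inter_eq_left.2 hBU] at h
  have htail : ∫⁻ x in Bᶜ, G x ≤ ENNReal.ofReal τ * g := by
    have h := lintegral_gaussian_tail_le hN hk (by positivity : 0 ≤ 2 * k * R) rfl
    have hc : Bᶜ = {x : EuclideanSpace ℝ (Fin N) | R < ∑ l : Fin N, x l ^ 2 / ((l : ℝ) + 1)} := by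
      ext x
      simp only [hB, Set.mem_compl_iff, Set.mem_ofPred_eq, not_le, hL']
    rwa [hc]
  have hsplit : (∫⁻ x in B, G x) + ∫⁻ x in Bᶜ, G x = g := lintegral_add_compl G hBm
  have hone : 1 ≤ ENNReal.ofReal (Real.exp (N / (9 * k))) * (K * g) := by
    rw [htot, mul_left_comm]; exact mul_le_mul_right hup _
  have hKg : K * g ≤ ENNReal.ofReal (Real.exp E) * μ (Θ '' B) + ENNReal.ofReal τ * (K * g) := by
    have h1 : ∫⁻ x in B, G x ≤ ENNReal.ofReal (Real.exp E) *
        ∫⁻ x in B, ENNReal.ofReal (logGasDensity k (L x)) := by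
      refine le_trans (le_of_eq ?_) (mul_le_mul_right hlow _)
      rw [← mul_assoc, ← ENNReal.ofReal_mul (Real.exp_nonneg _), ← Real.exp_add, ← hE,
        add_neg_cancel, Real.exp_zero, ENNReal.ofReal_one, one_mul]
    refine (mul_le_mul_right (hsplit.symm.le.trans (add_le_add h1 htail)) K).trans (le_of_eq ?_)
    rw [hball]; ring
  -- Total mass one forces a finite constant.
  have hKtop : K ≠ ⊤ := by
    rintro rfl
    rcases eq_or_ne (∫⁻ x in L ⁻¹' openCell N, ENNReal.ofReal (logGasDensity k (L x))) 0
      with h | h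
    · rw [h, mul_zero] at htot; exact one_ne_zero htot
    · rw [ENNReal.top_mul h] at htot; exact ENNReal.one_ne_top htot
  have hgtop : g ≠ ⊤ := by
    rw [hg, hG, lintegral_exp_neg_mul_norm_sq hk]; exact ENNReal.ofReal_ne_top
  have hKgtop : K * g ≠ ⊤ := ENNReal.mul_ne_top hKtop hgtop
  set q := (K * g).toReal with hq
  set m := μ.real (Θ '' B) with hm
  have hone' : 1 ≤ Real.exp (N / (9 * k)) * q := by
    have h := ENNReal.toReal_mono (ENNReal.mul_ne_top ENNReal.ofReal_ne_top hKgtop) hone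
    rwa [ENNReal.toReal_one, ENNReal.toReal_mul, ENNReal.toReal_ofReal (Real.exp_nonneg _)] at h
  have hKg' : q ≤ Real.exp E * m + τ * q := by
    have hf1 : ENNReal.ofReal (Real.exp E) * μ (Θ '' B) ≠ ⊤ :=
      ENNReal.mul_ne_top ENNReal.ofReal_ne_top (measure_ne_top _ _)
    have hf2 : ENNReal.ofReal τ * (K * g) ≠ ⊤ :=
      ENNReal.mul_ne_top ENNReal.ofReal_ne_top hKgtop
    have h := ENNReal.toReal_mono (ENNReal.add_ne_top.2 ⟨hf1, hf2⟩) hKg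
    rwa [ENNReal.toReal_add hf1 hf2, ENNReal.toReal_mul (a := ENNReal.ofReal _),
      ENNReal.toReal_mul (a := ENNReal.ofReal τ), ENNReal.toReal_ofReal (Real.exp_nonneg _),
      ENNReal.toReal_ofReal hτ0] at h
  have hcompl : μ.real {y | R < ‖(1 / √(2 * k)) • y - hermiteZeros N‖ ^ 2} = 1 - m := by
    have h := probReal_compl_eq_one_sub (μ := μ) hevent
    rw [hm, himg]; linarith
  rw [hcompl]
  have ha0 : 0 ≤ (N : ℝ) / (9 * k) := by positivity
  have hm0 : 0 ≤ m := measureReal_nonneg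
  rcases le_total 1 τ with h | h
  · linarith
  · have h1 : Real.exp (-(E + N / (9 * k))) * (1 - τ) ≤ m := by
      have h2 : (1 - τ) ≤ Real.exp (N / (9 * k)) * (Real.exp E * m) := by
        calc (1 - τ) ≤ (1 - τ) * (Real.exp (N / (9 * k)) * q) :=
              le_mul_of_one_le_right (by linarith) hone'
          _ = Real.exp (N / (9 * k)) * (q - τ * q) := by ring
          _ ≤ _ := mul_le_mul_of_nonneg_left (by linarith) (Real.exp_nonneg _)
      calc Real.exp (-(E + N / (9 * k))) * (1 - τ)
          ≤ Real.exp (-(E + N / (9 * k))) * (Real.exp (N / (9 * k)) * (Real.exp E * m)) :=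
            mul_le_mul_of_nonneg_left h2 (Real.exp_nonneg _)
        _ = m := by
            rw [← mul_assoc, ← mul_assoc, ← Real.exp_add, ← Real.exp_add,
              (by ring : -(E + N / (9 * k)) + N / (9 * k) + E = 0), Real.exp_zero, one_mul]
    have h3 := Real.add_one_le_exp (-(E + N / (9 * k)))
    have h4 : Real.exp (-(E + N / (9 * k))) * τ ≤ τ :=
      mul_le_of_le_one_left hτ0 (Real.exp_le_one_iff.2 (by linarith))
    linarith

/-- The explicit tail bound for the rescaled ensemble around the Hermite zeros. -/
theorem hermiteEnsemble_tail_le {N : ℕ} {k c : ℝ} (hN : 2 ≤ N) (hk : Real.exp 1 ≤ k)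
    (hc1 : √((1 + Real.log N) / (2 * Real.log k)) ≤ c)
    (hc2 : c ≤ 1 / 2 * √(k / (N * Real.log k))) [IsProbabilityMeasure (hermiteEnsemble N k)] :
    (hermiteEnsemble N k).real
        {y | c * √(Real.log k / k) < ‖(1 / √(2 * k)) • y - hermiteZeros N‖} ≤
      32 / 3 * c ^ 4 * (N : ℝ) ^ 3 * (Real.log k ^ 2 / k)
        + √(Real.exp 1) * N / 2 * (2 * c ^ 2 * Real.log k + 1) * k ^ (-(c ^ 2)) := by
  have hk0 : 0 < k := (Real.exp_pos 1).trans_le hk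
  have hlk : 1 ≤ Real.log k := by rw [Real.le_log_iff_exp_le hk0]; exact hk
  have hN2 : (2 : ℝ) ≤ N := by exact_mod_cast hN
  have hlN : 0 ≤ Real.log N := Real.log_nonneg (by linarith)
  have hc0 : 0 ≤ c := (Real.sqrt_nonneg _).trans hc1
  set S := c ^ 2 * Real.log k with hS
  set R := S / k with hR
  have hS1 : 1 / 2 ≤ S := by
    have h1 : (1 + Real.log N) / (2 * Real.log k) ≤ c ^ 2 := (Real.sqrt_le_left hc0).1 hc1
    rw [div_le_iff₀ (by positivity)] at h1
    rw [hS]; linarith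
  -- The upper limit on `c` is precisely the condition that keeps all relative gaps in the ball
  -- below `1/2` in modulus.
  have hNR : N * R ≤ 1 / 4 := by
    have h1 : c ^ 2 ≤ 1 / 4 * (k / (N * Real.log k)) := by
      calc c ^ 2 ≤ (1 / 2 * √(k / (N * Real.log k))) ^ 2 := by gcongr
        _ = _ := by rw [mul_pow, Real.sq_sqrt (by positivity)]; norm_num
    rw [hR, hS, mul_div_assoc', div_le_iff₀ hk0]
    calc (N : ℝ) * (c ^ 2 * Real.log k) = c ^ 2 * (N * Real.log k) := by ring
      _ ≤ 1 / 4 * (k / (N * Real.log k)) * (N * Real.log k) := by gcongr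
      _ = 1 / 4 * k := by field_simp
  have hset : {y : EuclideanSpace ℝ (Fin N) |
      c * √(Real.log k / k) < ‖(1 / √(2 * k)) • y - hermiteZeros N‖}
      = {y | R < ‖(1 / √(2 * k)) • y - hermiteZeros N‖ ^ 2} := by
    ext y
    have h1 : R = (c * √(Real.log k / k)) ^ 2 := by
      rw [mul_pow, Real.sq_sqrt (by positivity), hR, hS, mul_div_assoc]
    simp only [Set.mem_ofPred_eq, h1]
    exact (sq_lt_sq₀ (by positivity) (norm_nonneg _)).symm
  rw [hset]
  have hkR : 2 * k * R = 2 * S := by rw [hR]; field_simp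
  refine (hermiteEnsemble_concentration (by omega) hk0 (by positivity) hNR).trans
    (add_le_add ?_ ?_)
  · have h1 : 4 / 3 * k * (N * R) ^ 2 + N / (9 * k)
        = (4 / 3 * (N : ℝ) ^ 2 * S ^ 2 + N / 9) / k := by
      rw [hR]; field_simp
    have h2 : 32 / 3 * c ^ 4 * (N : ℝ) ^ 3 * (Real.log k ^ 2 / k)
        = (32 / 3 * (N : ℝ) ^ 3 * S ^ 2) / k := by
      rw [hS]; field_simp
    rw [h1, h2]
    refine div_le_div_of_nonneg_right ?_ hk0.le
    have h3 : (1 : ℝ) / 4 ≤ S ^ 2 := by nlinarith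
    have h4 : (N : ℝ) ^ 2 ≤ (N : ℝ) ^ 3 := pow_le_pow_right₀ (by linarith) (by norm_num)
    have h5 : (N : ℝ) ≤ (N : ℝ) ^ 3 := le_self_pow₀ (by linarith) (by norm_num)
    nlinarith [mul_le_mul_of_nonneg_right h4 (sq_nonneg S),
      mul_le_mul h5 h3 (by norm_num) (by positivity)]
  · rw [hkR]
    have h1 : Real.exp (-(2 * S) / 2) = k ^ (-(c ^ 2)) := by
      rw [Real.rpow_def_of_pos hk0, hS]; congr 1; ring
    -- `√y ≤ y / 2` for `y ≥ 4`; here `N ≥ 2` and `2 S + 1 ≥ 2`.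
    have h2 : √(N * (2 * S + 1)) ≤ N * (2 * S + 1) / 2 := by
      rw [Real.sqrt_le_left (by positivity)]
      have : 4 ≤ (N : ℝ) * (2 * S + 1) := by nlinarith
      nlinarith
    rw [h1]
    refine mul_le_mul_of_nonneg_right ?_ (Real.rpow_nonneg hk0.le _)
    calc √(Real.exp 1) * √(N * (2 * S + 1)) ≤ √(Real.exp 1) * (N * (2 * S + 1) / 2) := by gcongr
      _ = _ := by rw [hS]; ring

/-! ### Uniformity in the dimension. -/

/-- Outside the admissible range, either `k ^ (c²) ≤ e N` (lower condition fails) or `k ≤ 4 N log k`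
(upper condition fails), so the target bound is trivial for a probability. -/
theorem one_le_of_not_admissible {N : ℕ} {k c : ℝ} (hN : 2 ≤ N) (hk : Real.exp 1 ≤ k)
    (hc0 : 0 < c) (hc1 : c ≤ 1)
    (h : ¬ (√((1 + Real.log N) / (2 * Real.log k)) ≤ c ∧
      c ≤ 1 / 2 * √(k / (N * Real.log k)))) :
    1 ≤ 4 * ((N : ℝ) ^ 3 * (Real.log k / k ^ (c ^ 2))) := by
  have hk0 : 0 < k := (Real.exp_pos 1).trans_le hk
  have hk1 : 1 ≤ k := (Real.one_le_exp zero_le_one).trans hk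
  have hlk : 1 ≤ Real.log k := by rw [Real.le_log_iff_exp_le hk0]; exact hk
  have hN2 : (2 : ℝ) ≤ N := by exact_mod_cast hN
  have hN3 : (N : ℝ) ≤ (N : ℝ) ^ 3 := le_self_pow₀ (by linarith) (by norm_num)
  have hcc : c ^ 2 ≤ 1 := pow_le_one₀ hc0.le hc1
  have hkc : 0 < k ^ (c ^ 2) := Real.rpow_pos_of_pos hk0 _
  suffices hmain : k ^ (c ^ 2) ≤ 4 * (N * Real.log k) by
    have h1 : (1 : ℝ) ≤ 4 * (N * (Real.log k / k ^ (c ^ 2))) := by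
      rw [mul_div_assoc', mul_div_assoc', le_div_iff₀ hkc, one_mul]
      exact hmain
    refine h1.trans ?_
    gcongr
  rw [not_and_or, not_le, not_le] at h
  rcases h with h | h
  · have h1 : c ^ 2 < (1 + Real.log N) / (2 * Real.log k) := (Real.lt_sqrt hc0.le).1 h
    rw [lt_div_iff₀ (by positivity)] at h1
    have h2 : k ^ (c ^ 2) ≤ Real.exp 1 * N := by
      rw [Real.rpow_def_of_pos hk0]
      conv_rhs => rw [← Real.exp_log (by linarith : (0 : ℝ) < N), ← Real.exp_add]
      refine Real.exp_le_exp.2 ?_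
      nlinarith [mul_nonneg (sq_nonneg c) (by linarith : 0 ≤ Real.log k)]
    have h3 : Real.exp 1 ≤ 4 := by linarith [Real.exp_one_lt_d9]
    calc k ^ (c ^ 2) ≤ Real.exp 1 * N := h2
      _ ≤ 4 * (N * Real.log k) := by
          refine mul_le_mul h3 (le_mul_of_one_le_right (by linarith) hlk) (by linarith) (by norm_num)
  · have h1 : √(k / (N * Real.log k)) ≤ 2 := by linarith
    rw [Real.sqrt_le_left (by norm_num), div_le_iff₀ (by positivity)] at h1
    calc k ^ (c ^ 2) ≤ k ^ (1 : ℝ) := Real.rpow_le_rpow_of_exponent_le hk1 hcc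
      _ = k := Real.rpow_one k
      _ ≤ 4 * (N * Real.log k) := by linarith

theorem gaussian_term_le {N : ℕ} {k c : ℝ} (hN : 2 ≤ N) (hk : Real.exp 1 ≤ k)
    (hc0 : 0 < c) (hc1 : c ≤ 1) :
    √(Real.exp 1) * N / 2 * (2 * c ^ 2 * Real.log k + 1) * k ^ (-(c ^ 2)) ≤
      3 * ((N : ℝ) ^ 3 * (Real.log k / k ^ (c ^ 2))) := by
  have hk0 : 0 < k := (Real.exp_pos 1).trans_le hk
  have hlk : 1 ≤ Real.log k := by rw [Real.le_log_iff_exp_le hk0]; exact hk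
  have hN2 : (2 : ℝ) ≤ N := by exact_mod_cast hN
  have hN3 : (N : ℝ) ≤ (N : ℝ) ^ 3 := le_self_pow₀ (by linarith) (by norm_num)
  have hcc : c ^ 2 ≤ 1 := pow_le_one₀ hc0.le hc1
  have he : √(Real.exp 1) ≤ 2 := by
    rw [Real.sqrt_le_left (by norm_num)]; linarith [Real.exp_one_lt_d9]
  have h1 : √(Real.exp 1) * N / 2 ≤ (N : ℝ) ^ 3 := by nlinarith
  have h2 : 2 * c ^ 2 * Real.log k + 1 ≤ 3 * Real.log k := by nlinarith
  rw [Real.rpow_neg hk0.le]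
  calc _ ≤ (N : ℝ) ^ 3 * (3 * Real.log k) * (k ^ (c ^ 2))⁻¹ := by gcongr
    _ = _ := by rw [div_eq_mul_inv]; ring

theorem corollary2p5
    {Ω : ℕ → ℝ → Type*} [∀ N k, MeasurableSpace (Ω N k)]
    (P : ∀ N k, Measure (Ω N k)) [∀ N k, IsProbabilityMeasure (P N k)]
    (X : ∀ N k, Ω N k → EuclideanSpace ℝ (Fin N))
    (hX : ∀ (N : ℕ) (k : ℝ), 2 ≤ N → 0 < k → HasLaw (X N k) (hermiteEnsemble N k) (P N k)) :
    (∀ (N : ℕ) (k c : ℝ), 2 ≤ N → Real.exp 1 ≤ k →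
      √((1 + Real.log N) / (2 * Real.log k)) ≤ c →
      c ≤ 1 / 2 * √(k / (N * Real.log k)) →
      (P N k).real {ω | c * √(Real.log k / k) < ‖(1 / √(2 * k)) • X N k ω - hermiteZeros N‖}
        ≤ 32 / 3 * c ^ 4 * (N : ℝ) ^ 3 * (Real.log k ^ 2 / k)
          + √(Real.exp 1) * N / 2 * (2 * c ^ 2 * Real.log k + 1) * k ^ (-(c ^ 2))) ∧
    (∃ C : ℝ, ∀ᶠ k : ℝ in atTop, ∀ N : ℕ, 2 ≤ N →
      (P N k).real {ω | √(Real.log k / k) < ‖(1 / √(2 * k)) • X N k ω - hermiteZeros N‖}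
        ≤ C * ((N : ℝ) ^ 3 * (Real.log k ^ 2 / k))) ∧
    (∀ c : ℝ, 0 < c → c < 1 → ∃ C : ℝ, ∀ᶠ k : ℝ in atTop, ∀ N : ℕ, 2 ≤ N →
      (P N k).real {ω | c * √(Real.log k / k) < ‖(1 / √(2 * k)) • X N k ω - hermiteZeros N‖}
        ≤ C * ((N : ℝ) ^ 3 * (Real.log k / k ^ (c ^ 2)))) := by
  have main : ∀ (N : ℕ) (k c : ℝ), 2 ≤ N → Real.exp 1 ≤ k →
      √((1 + Real.log N) / (2 * Real.log k)) ≤ c →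
      c ≤ 1 / 2 * √(k / (N * Real.log k)) →
      (P N k).real {ω | c * √(Real.log k / k) < ‖(1 / √(2 * k)) • X N k ω - hermiteZeros N‖}
        ≤ 32 / 3 * c ^ 4 * (N : ℝ) ^ 3 * (Real.log k ^ 2 / k)
          + √(Real.exp 1) * N / 2 * (2 * c ^ 2 * Real.log k + 1) * k ^ (-(c ^ 2)) := by
    intro N k c hN hk hc1 hc2
    have hlaw := hX N k hN ((Real.exp_pos 1).trans_le hk)
    -- The existence of a random vector with this law already contains the normalization.
    have : IsProbabilityMeasure (hermiteEnsemble N k) := by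
      rw [← hlaw.map_eq]; exact Measure.isProbabilityMeasure_map hlaw.aemeasurable
    have hmeas : MeasurableSet {y : EuclideanSpace ℝ (Fin N) |
        c * √(Real.log k / k) < ‖(1 / √(2 * k)) • y - hermiteZeros N‖} :=
      measurableSet_lt measurable_const (by fun_prop)
    have heq := congrArg ENNReal.toReal (hlaw.measure_eq hmeas)
    exact heq.le.trans (hermiteEnsemble_tail_le hN hk hc1 hc2)
  -- `14` dominates `32/3 + 3`, from the two terms of the explicit bound, and the `4` of the
  -- inadmissible case; likewise for the second constant.
  refine ⟨main, ⟨14, ?_⟩, fun c hc0 hc1 => ⟨32 / 3 / (1 - c ^ 2) + 4, ?_⟩⟩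
  · filter_upwards [eventually_ge_atTop (Real.exp 1)] with k hk N hN
    have hk0 : 0 < k := (Real.exp_pos 1).trans_le hk
    have hlk : 1 ≤ Real.log k := by rw [Real.le_log_iff_exp_le hk0]; exact hk
    have hQ : (N : ℝ) ^ 3 * (Real.log k / k ^ ((1 : ℝ) ^ 2))
        ≤ (N : ℝ) ^ 3 * (Real.log k ^ 2 / k) := by
      rw [one_pow, Real.rpow_one]
      gcongr
      exact le_self_pow₀ hlk two_ne_zero
    have hQ0 : 0 ≤ (N : ℝ) ^ 3 * (Real.log k ^ 2 / k) := by positivity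
    by_cases h : √((1 + Real.log N) / (2 * Real.log k)) ≤ 1 ∧
        1 ≤ 1 / 2 * √(k / (N * Real.log k))
    · have h1 := main N k 1 hN hk h.1 h.2
      have h2 := gaussian_term_le hN hk one_pos le_rfl
      simp only [one_mul] at h1
      linarith
    · have h1 := one_le_of_not_admissible hN hk one_pos le_rfl h
      have h2 : (P N k).real
          {ω | √(Real.log k / k) < ‖(1 / √(2 * k)) • X N k ω - hermiteZeros N‖} ≤ 1 :=
        measureReal_le_one
      linarith
  · filter_upwards [eventually_ge_atTop (Real.exp 1)] with k hk N hN
    have hk0 : 0 < k := (Real.exp_pos 1).trans_le hk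
    have hlk : 1 ≤ Real.log k := by rw [Real.le_log_iff_exp_le hk0]; exact hk
    have hε : 0 < 1 - c ^ 2 := by nlinarith
    have hQ0 : 0 ≤ (N : ℝ) ^ 3 * (Real.log k / k ^ (c ^ 2)) := by positivity
    have hε0 : 0 ≤ 32 / 3 / (1 - c ^ 2) := by positivity
    have hεQ := mul_nonneg hε0 hQ0
    rw [add_mul]
    by_cases h : √((1 + Real.log N) / (2 * Real.log k)) ≤ c ∧
        c ≤ 1 / 2 * √(k / (N * Real.log k))
    · have h1 := main N k c hN hk h.1 h.2
      have h2 := gaussian_term_le hN hk hc0 hc1.le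
      have h3 : 32 / 3 * c ^ 4 * (N : ℝ) ^ 3 * (Real.log k ^ 2 / k)
          ≤ 32 / 3 / (1 - c ^ 2) * ((N : ℝ) ^ 3 * (Real.log k / k ^ (c ^ 2))) := by
        -- One logarithm is absorbed through `log k ≤ k ^ (1 - c²) / (1 - c²)`, which needs `c < 1`
        -- and makes the constant depend on `c`.
        have h4 : Real.log k / k ≤ 1 / (1 - c ^ 2) / k ^ (c ^ 2) := by
          have h5 := Real.log_le_rpow_div hk0.le hε
          rw [Real.rpow_sub hk0, Real.rpow_one] at h5
          rw [div_le_iff₀ hk0]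
          refine h5.trans (le_of_eq ?_)
          field_simp
        calc 32 / 3 * c ^ 4 * (N : ℝ) ^ 3 * (Real.log k ^ 2 / k)
            = c ^ 4 * (32 / 3 * (N : ℝ) ^ 3 * Real.log k * (Real.log k / k)) := by ring
          _ ≤ 1 * (32 / 3 * (N : ℝ) ^ 3 * Real.log k * (1 / (1 - c ^ 2) / k ^ (c ^ 2))) := by
              gcongr
              exact pow_le_one₀ hc0.le hc1.le
          _ = _ := by ring
      linarith
    · have h1 := one_le_of_not_admissible hN hk hc0 hc1.le h
      have h2 : (P N k).real
          {ω | c * √(Real.log k / k) < ‖(1 / √(2 * k)) • X N k ω - hermiteZeros N‖} ≤ 1 :=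
        measureReal_le_one
      linarith
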